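/- Let $N\ge 1$, let $K$ be a field of characteristic $0$ (for instance $\mathbb R$, or $\mathbb Q(\alpha)$ with $\alpha$ an indeterminate), and let $\alpha\in K$ not be a rational number $\le 0$. Permutations act on $K[z_1,\dots,z_N]$ by permuting variables; $s_{ip}$ exchanges $z_i$ and $z_p$, and $s_i:=s_{i\,i+1}$. Let $$\xi_i=\alpha z_i\frac{\partial}{\partial z_i}+\sum_{p<i}\frac{z_i}{z_i-z_p}(1-s_{ip})+\sum_{p>i}\frac{z_p}{z_i-z_p}(1-s_{ip})+1-i\qquad(1\le i\le N)$$ and $D_{v}=\frac1\alpha\sum_{j=1}^N v_j\bigl(\xi_j+\frac{N-1}{2}\bigr)$ for a vector $v=(v_1,\dots,v_N)$. In particular $D_\beta=\frac1\alpha(\xi_j-\xi_k)$ for $\beta=e_j-e_k$. For a composition $\eta=(\eta_1,\dots,\eta_N)$ of non-negative integers put $\bar\eta_i=\alpha\eta_i-\#\{k<i:\eta_k\ge\eta_i\}-\#\{k>i:\eta_k>\eta_i\}$, and let $\eta^+$ be its decreasing rearrangement. For $\nu\neq\eta$ with $\sum_j\nu_j=\sum_j\eta_j$ write $\nu<\eta$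 if $\nu_1+\dots+\nu_p\le\eta_1+\dots+\eta_p$ for all $p$, and write $\nu\prec\eta$ if $\nu^+<\eta^+$, or $\nu^+=\eta^+$ and $\nu<\eta$. The nonsymmetric Jack polynomial $E_\eta$ is the polynomial with $\xi_iE_\eta=\bar\eta_iE_\eta$ for all $i$ and $E_\eta=z^\eta+\sum_{\nu\prec\eta}c_{\eta\nu}z^\nu$. Let $I,J\subseteq\{1,\dots,N-1\}$ be disjoint and such that no element of $I$ is adjacent to an element of $J$ (that is, $|i-j|\neq1$ for $i\in I$, $j\in J$). Let $W_{I\cup J}$ be the group generated by the $s_i$ with $i\in I\cup J$. For $w\in W_{I\cup J}$ let $\det_J(w)=\pm1$ be the parity of the number of factors $s_j$ with $j\in J$ in a decomposition of $w$ into such generators. Let $\eta^*$ be a composition with $\eta^*_i\ge\eta^*_{i+1}$ for $i\in I$ and $\eta^*_j>\eta^*_{j+1}$ for $j\in J$. The Jack polynomial with prescribed symmetry $S^{(I,J)}_{\eta^*}$ is the polynomial of the form $z^{\eta^*}+\sum_{\nu\prec\eta^*}\tilde c_\nu z^\nu$ such that $\sum_{w\in W_{I\cup J}}\det_J(w)\,wE_{\eta^*}=a\,S^{(I,J)}_{\eta^*}$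 for some nonzero $a\in K$. Write $J$ as the union of its maximal runs $J_s$ of consecutive integers, put $\tilde J_s=J_s\cup\{\max J_s+1\}$, and let $$R_{J,+}=\{e_j-e_k : j<k,\ j,k\in\tilde J_s\text{ for some }s\},\qquad O_J=\prod_{\beta\in R_{J,+}}\Bigl(D_\beta+\frac1\alpha\Bigr),$$ where the factors may be taken in any order. **Proposition.** The polynomials $E_{\eta^*}$, $S^{(I,J)}_{\eta^*}$ and $S^{(I\cup J,\emptyset)}_{\eta^*}$ exist. For all $i\in I\cup J$, $$s_i\bigl(O_JS^{(I,J)}_{\eta^*}\bigr)=O_JS^{(I,J)}_{\eta^*}.$$ Moreover $$O_JS^{(I,J)}_{\eta^*}=c_{\eta^*}\,S^{(I\cup J,\emptyset)}_{\eta^*},\qquad c_{\eta^*}=\prod_{e_j-e_k\in R_{J,+}}\frac{\overline{\eta^*}_j-\overline{\eta^*}_k+1}{\alpha}.$$ -/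

import Mathlib

open MvPolynomial

namespace PrescribedJack

/-!  The number of variables is `N = n + 1`.  Positions `1, …, N` are the elements of `Fin (n + 1)`,
and the labels `1, …, N - 1` of the simple transpositions are the elements of `Fin n`. -/

section Combinatorics

variable {n : ℕ}

/-- The simple transposition `s_i`, which interchanges the positions `i` and `i + 1`. -/
def simpleRefl (i : Fin n) : Equiv.Perm (Fin (n + 1)) :=
  Equiv.swap i.castSucc i.succ

/-- The group generated by the simple transpositions `s_i` with `i ∈ A`. -/
def parabolic (A : Finset (Fin n)) : Subgroup (Equiv.Perm (Fin (n + 1))) :=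
  Subgroup.closure (simpleRefl '' (A : Set (Fin n)))

open Classical in
/-- The sign `det_J w` of an element `w` of the group generated by the `s_i` with `i ∈ I ∪ J`:
it is `1` if `w` has a decomposition into such transpositions with an even number of factors from
`{s_j | j ∈ J}`, and `-1` otherwise. -/
noncomputable def detJ (I J : Finset (Fin n)) (w : Equiv.Perm (Fin (n + 1))) : ℤ :=
  if ∃ l : List (Fin n), (∀ i ∈ l, i ∈ I ∪ J) ∧ (l.map simpleRefl).prod = w ∧
      Even (l.countP (fun i => decide (i ∈ J)))
  then 1 else -1

open Classical in
/-- The set `R_{J,+}` of positive roots `e_j - e_k`, coded by the pairs `(j, k)`, such that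
`j < k` lie in a common block `J_s ∪ {max J_s + 1}`, where `J_s` is a maximal run of consecutive
elements of `J`.  Equivalently, all of `j, j + 1, …, k - 1` are in `J`. -/
noncomputable def posRoots (J : Finset (Fin n)) : Finset (Fin (n + 1) × Fin (n + 1)) :=
  Finset.univ.filter fun b =>
    b.1 < b.2 ∧ ∀ i : Fin n, b.1 ≤ i.castSucc → i.castSucc < b.2 → i ∈ J

/-- The decreasing rearrangement `η⁺` of a composition. -/
def sortDesc (η : Fin (n + 1) → ℕ) : Fin (n + 1) → ℕ :=
  η ∘ Tuple.sort (fun i => OrderDual.toDual (η i))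

/-- The strict dominance order on compositions of the same degree. -/
def DomLT (ν η : Fin (n + 1) → ℕ) : Prop :=
  ν ≠ η ∧ ∑ j, ν j = ∑ j, η j ∧
    ∀ p, ∑ j ∈ Finset.Iic p, ν j ≤ ∑ j ∈ Finset.Iic p, η j

/-- The order `ν ≺ η`: either `ν⁺ < η⁺`, or `ν⁺ = η⁺` and `ν < η`. -/
def Prec (ν η : Fin (n + 1) → ℕ) : Prop :=
  DomLT (sortDesc ν) (sortDesc η) ∨ (sortDesc ν = sortDesc η ∧ DomLT ν η)

end Combinatorics

section Operators

variable {K : Type*} [Field K] {n : ℕ}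

/-- The action `f ↦ f (…, z_{w i}, …)` of a permutation; it maps `z^η` to `z^{w η}`. -/
noncomputable def permAct (w : Equiv.Perm (Fin (n + 1))) :
    MvPolynomial (Fin (n + 1)) K →ₗ[K] MvPolynomial (Fin (n + 1)) K :=
  (rename w : MvPolynomial (Fin (n + 1)) K →ₐ[K] MvPolynomial (Fin (n + 1)) K).toLinearMap

theorem sub_dvd_sub_permAct (i p : Fin (n + 1)) (f : MvPolynomial (Fin (n + 1)) K) :
    (X i - X p : MvPolynomial (Fin (n + 1)) K) ∣ f - permAct (Equiv.swap i p) f := by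
  set Q := Ideal.span {(X i - X p : MvPolynomial (Fin (n + 1)) K)} with hQ
  have hx : Ideal.Quotient.mk Q (X i) = Ideal.Quotient.mk Q (X p) := by
    rw [Ideal.Quotient.eq]
    exact Ideal.subset_span rfl
  have h : (Ideal.Quotient.mkₐ K Q).comp (rename (Equiv.swap i p)) = Ideal.Quotient.mkₐ K Q := by
    ext j
    simp only [AlgHom.comp_apply, rename_X, Ideal.Quotient.mkₐ_eq_mk]
    by_cases h1 : j = i
    · subst h1; simp [hx]
    · by_cases h2 : j = p
      · subst h2; simp [hx]
      · rw [Equiv.swap_apply_of_ne_of_ne h1 h2]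
  have h3 := DFunLike.congr_fun h f
  simp only [AlgHom.comp_apply, Ideal.Quotient.mkₐ_eq_mk] at h3
  rw [← Ideal.mem_span_singleton, ← hQ, ← Ideal.Quotient.eq]
  exact h3.symm

/-- For `i ≠ p`, the operator `(z_i - z_p)⁻¹ (1 - s_{ip})` on polynomials: the unique polynomial
quotient of `f - s_{ip} f` by `z_i - z_p`.  For `i = p` it is set to be `0`. -/
noncomputable def divDiff (i p : Fin (n + 1)) :
    MvPolynomial (Fin (n + 1)) K →ₗ[K] MvPolynomial (Fin (n + 1)) K :=
  if h : i = p then 0 else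
    have h0 : (X i - X p : MvPolynomial (Fin (n + 1)) K) ≠ 0 :=
      fun e => h (X_injective (sub_eq_zero.mp e))
    { toFun := fun f => (sub_dvd_sub_permAct i p f).choose
      map_add' := fun f g => by
        apply mul_left_cancel₀ h0
        rw [← (sub_dvd_sub_permAct i p (f + g)).choose_spec, mul_add,
          ← (sub_dvd_sub_permAct i p f).choose_spec, ← (sub_dvd_sub_permAct i p g).choose_spec,
          map_add]
        ring
      map_smul' := fun c f => by
        apply mul_left_cancel₀ h0
        rw [← (sub_dvd_sub_permAct i p (c • f)).choose_spec, RingHom.id_apply, mul_smul_comm,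
          ← (sub_dvd_sub_permAct i p f).choose_spec, map_smul, smul_sub] }

theorem divDiff_spec {i p : Fin (n + 1)} (h : i ≠ p) (f : MvPolynomial (Fin (n + 1)) K) :
    (X i - X p) * divDiff i p f = f - permAct (Equiv.swap i p) f := by
  rw [divDiff, dif_neg h]
  exact (sub_dvd_sub_permAct i p f).choose_spec.symm

/-- The Cherednik operator
`ξ_i = α z_i ∂_i + ∑_{p < i} z_i / (z_i - z_p) (1 - s_{ip})
  + ∑_{p > i} z_p / (z_i - z_p) (1 - s_{ip}) + 1 - i`
(here `i` counts from `0`, so that the additive constant is `-i`). -/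
noncomputable def xi (α : K) (i : Fin (n + 1)) :
    Module.End K (MvPolynomial (Fin (n + 1)) K) :=
  α • (LinearMap.mulLeft K (X i) ∘ₗ (pderiv i).toLinearMap)
    + ∑ p ∈ Finset.Iio i, LinearMap.mulLeft K (X i) ∘ₗ divDiff i p
    + ∑ p ∈ Finset.Ioi i, LinearMap.mulLeft K (X p) ∘ₗ divDiff i p
    - ((i : ℕ) : K) • 1

/-- The operator `D_v = α⁻¹ ∑_j v_j (ξ_j + (N - 1) / 2)` attached to a vector `v`. -/
noncomputable def cherednikD (α : K) (v : Fin (n + 1) → K) :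
    Module.End K (MvPolynomial (Fin (n + 1)) K) :=
  α⁻¹ • ∑ j, v j • (xi α j + ((n : K) / 2) • 1)

/-- The root `e_j - e_k` coded by the pair `(j, k)`. -/
def root (b : Fin (n + 1) × Fin (n + 1)) : Fin (n + 1) → K :=
  Pi.single b.1 1 - Pi.single b.2 1

/-- The product of the operators `D_β + 1 / α`, over the roots `β` in a list, in this order. -/
noncomputable def opO (α : K) (L : List (Fin (n + 1) × Fin (n + 1))) :
    Module.End K (MvPolynomial (Fin (n + 1)) K) :=
  (L.map fun b => cherednikD α (root b) + (1 / α) • 1).prod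

/-- `η̄_i = α η_i - #{k < i | η_k ≥ η_i} - #{k > i | η_k > η_i}`. -/
def etaBar (α : K) (η : Fin (n + 1) → ℕ) (i : Fin (n + 1)) : K :=
  α * (η i : K) - (((Finset.Iio i).filter fun k => η i ≤ η k).card : K)
    - (((Finset.Ioi i).filter fun k => η i < η k).card : K)

/-- `c_η = ∏_{β ∈ R_{J,+}} (η̄_j - η̄_k + 1) / α`, where `β = e_j - e_k`. -/
noncomputable def constC (α : K) (J : Finset (Fin n)) (η : Fin (n + 1) → ℕ) : K :=
  ∏ b ∈ posRoots J, (etaBar α η b.1 - etaBar α η b.2 + 1) / α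

/-- `f = z^η + ∑_{ν ≺ η} c_ν z^ν` for some coefficients `c_ν`. -/
def IsMonicTriangular (η : Fin (n + 1) → ℕ) (f : MvPolynomial (Fin (n + 1)) K) : Prop :=
  coeff (Finsupp.equivFunOnFinite.symm η) f = 1 ∧
    ∀ ν : Fin (n + 1) → ℕ, coeff (Finsupp.equivFunOnFinite.symm ν) f ≠ 0 → ν = η ∨ Prec ν η

/-- The characterization of the nonsymmetric Jack polynomial `E_η`. -/
def IsNonsymJack (α : K) (η : Fin (n + 1) → ℕ) (E : MvPolynomial (Fin (n + 1)) K) : Prop :=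
  (∀ i, xi α i E = etaBar α η i • E) ∧ IsMonicTriangular η E

/-- The nonsymmetric Jack polynomial `E_η`. -/
noncomputable def nonsymJack (α : K) (η : Fin (n + 1) → ℕ) : MvPolynomial (Fin (n + 1)) K :=
  Classical.epsilon (IsNonsymJack α η)

open Classical in
/-- The operator `f ↦ ∑_{w ∈ W_{I ∪ J}} det_J(w) w f`, which symmetrizes with respect to the `s_i`
with `i ∈ I` and antisymmetrizes with respect to the `s_j` with `j ∈ J`. -/
noncomputable def symAsym (I J : Finset (Fin n)) :
    Module.End K (MvPolynomial (Fin (n + 1)) K) :=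
  ∑ w ∈ Finset.univ.filter (fun w : Equiv.Perm (Fin (n + 1)) => w ∈ parabolic (I ∪ J)),
    detJ I J w • permAct w

/-- The characterization of the Jack polynomial with prescribed symmetry `S_η^{(I,J)}`: a nonzero
multiple of it is the (anti)symmetrization of `E_η`, and it is of the form `z^η + ⋯`. -/
def IsPrescribedJack (α : K) (I J : Finset (Fin n)) (η : Fin (n + 1) → ℕ)
    (S : MvPolynomial (Fin (n + 1)) K) : Prop :=
  (∃ a : K, a ≠ 0 ∧ symAsym I J (nonsymJack α η) = a • S) ∧ IsMonicTriangular η S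

/-- The Jack polynomial with prescribed symmetry `S_η^{(I,J)}`. -/
noncomputable def prescribedJack (α : K) (I J : Finset (Fin n)) (η : Fin (n + 1) → ℕ) :
    MvPolynomial (Fin (n + 1)) K :=
  Classical.epsilon (IsPrescribedJack α I J η)

end Operators

end PrescribedJack

open PrescribedJack

/-! On each nonsymmetric Jack polynomial E_ν the operator O_J acts by the scalar `constC α J ν`, so
the statement becomes a comparison of coefficients once both prescribed-symmetry polynomials are
expanded in the E_ν with ν in the W_{I∪J}-orbit of η. The expansion is explicit: the coefficient of
E_ν (`expCoeff`) is the product of ±1 + 1/(ν̄_j - ν̄_k) over the positive roots e_j - e_k of I ∪ J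
with ν_j < ν_k, the sign being -1 exactly for the roots in R_{J,+}. The identity that carries
everything is (-1 + 1/d)(1 + d) = (1 + 1/d)(1 - d) with d = ν̄_j - ν̄_k. It says that the eigenvalue
of O_J turns antisymmetric factors into symmetric ones, and it gives `expCoeff_mul_constC`: O_J
times one expansion is c_η times the other, term by term. Symmetry of the image follows from that of
S^{(I∪J,∅)}. The expansion rests on the action of s_i on E_ν (`permAct_nonsymJack_of_lt`, `_of_eq`,
`_of_gt`), which shows that the sum transforms by ε_i = ±1 under s_i (`permAct_expansion`); since
every symmetrized E_ν of the orbit is a multiple of the symmetrized E_η, the sum is S^{(I,J)}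
(`isPrescribedJack_expansion`). Existence of E_η has three sources: the ξ_i are triangular with
diagonal entries η̄_i (`xi_mono_sub_mem`); the vector η̄ determines η because α is not a rational ≤
0 (`eq_comp_of_etaBar_eq`); and nonzero joint eigenvectors are built from the constant 1 by a
degree-raising operator and intertwiners (`exists_joint_eigenvector`). Triangularity of an
eigenvector is then automatic. -/

namespace PrescribedJack

/-! ### Spectral vectors: η̄_i is α η_i minus the rank of position i. -/

section Rank

variable {n : ℕ}

/-- Position `k` precedes position `i` when the parts of `ν` are listed in decreasing order,
equal parts being listed from left to right. -/
def Before (ν : Fin (n + 1) → ℕ) (k i : Fin (n + 1)) : Prop :=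
  ν i < ν k ∨ (ν i = ν k ∧ k < i)

open Classical in
/-- The number of positions which precede `i`. -/
noncomputable def rk (ν : Fin (n + 1) → ℕ) (i : Fin (n + 1)) : ℕ :=
  (Finset.univ.filter fun k => Before ν k i).card

theorem Before.trans {ν : Fin (n + 1) → ℕ} {i j k : Fin (n + 1)}
    (h1 : Before ν i j) (h2 : Before ν j k) : Before ν i k := by
  unfold Before at *; omega

theorem Before.irrefl {ν : Fin (n + 1) → ℕ} {i : Fin (n + 1)} : ¬ Before ν i i := by
  unfold Before; omega

theorem before_or_before (ν : Fin (n + 1) → ℕ) {j k : Fin (n + 1)} (h : j ≠ k) :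
    Before ν j k ∨ Before ν k j := by
  unfold Before; omega

theorem Before.rk_lt {ν : Fin (n + 1) → ℕ} {j k : Fin (n + 1)} (h : Before ν j k) :
    rk ν j < rk ν k := by
  classical
  apply Finset.card_lt_card
  rw [Finset.ssubset_iff_of_subset]
  · exact ⟨j, by simpa using h, by simpa using Before.irrefl⟩
  · intro i hi
    simp only [Finset.mem_filter, Finset.mem_univ, true_and] at hi ⊢
    exact hi.trans h

theorem rk_congr {μ ν : Fin (n + 1) → ℕ} (w : Equiv.Perm (Fin (n + 1))) {i : Fin (n + 1)}
    (h : ∀ k, Before μ k i ↔ Before ν (w k) (w i)) : rk μ i = rk ν (w i) := by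
  classical
  apply Finset.card_bij (fun k _ => w k)
  · intro k hk
    simpa [h] using hk
  · intro a _ b _ hab
    exact w.injective hab
  · intro b hb
    refine ⟨w.symm b, ?_, by simp⟩
    simpa [h] using hb

variable {K : Type*} [Field K] (α : K)

theorem etaBar_eq (ν : Fin (n + 1) → ℕ) (i : Fin (n + 1)) :
    etaBar α ν i = α * ν i - rk ν i := by
  classical
  rw [etaBar, sub_sub, ← Nat.cast_add, rk, ← Finset.card_union_of_disjoint]
  · congr 3
    ext k
    simp only [Finset.mem_union, Finset.mem_filter, Finset.mem_Iio, Finset.mem_Ioi,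
      Finset.mem_univ, true_and]
    unfold Before
    have : k = i → ν k = ν i := fun h => by rw [h]
    omega
  · rw [Finset.disjoint_left]
    intro k hk hk'
    simp only [Finset.mem_filter, Finset.mem_Iio, Finset.mem_Ioi] at hk hk'
    omega

theorem Before.etaBar_sub {ν : Fin (n + 1) → ℕ} {j k : Fin (n + 1)} (h : Before ν j k) :
    ∃ r : ℕ, 1 ≤ r ∧ etaBar α ν j - etaBar α ν k = α * ((ν j - ν k : ℕ) : K) + r := by
  have h1 := h.rk_lt
  have h2 : ν k ≤ ν j := by unfold Before at h; omega
  refine ⟨rk ν k - rk ν j, by omega, ?_⟩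
  rw [etaBar_eq, etaBar_eq, Nat.cast_sub h2, Nat.cast_sub h1.le]
  ring

variable [CharZero K] {α}

/-- Vanishing with m ≥ 1 would make α the rational number -r/m ≤ 0. All genericity of α enters
through this and through α ≠ 0. -/
theorem mul_add_ne_zero (hα : ∀ q : ℚ, q ≤ 0 → α ≠ (q : K)) {m r : ℕ}
    (h : 1 ≤ m ∨ 1 ≤ r) : α * m + r ≠ 0 := by
  intro e
  rcases Nat.eq_zero_or_pos m with hm | hm
  · subst hm
    simp only [Nat.cast_zero, mul_zero, zero_add, Nat.cast_eq_zero] at e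
    omega
  · apply hα (-(r : ℚ) / m)
    · rw [neg_div, neg_nonpos]; positivity
    · have : (m : K) ≠ 0 := by exact_mod_cast hm.ne'
      push_cast
      field_simp
      linear_combination e

omit [CharZero K] in
theorem alpha_ne_zero (hα : ∀ q : ℚ, q ≤ 0 → α ≠ (q : K)) : α ≠ 0 := by
  simpa using hα 0 le_rfl

/-- The difference is α m + r with m, r ≥ 1, and adding 0 or ±1 keeps it of the form α m + r' with
r' ≥ 0. The excluded values are those where the intertwiner of s_i has a pole or may degenerate. -/
theorem etaBar_sub_ne (hα : ∀ q : ℚ, q ≤ 0 → α ≠ (q : K)) {ν : Fin (n + 1) → ℕ}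
    {j k : Fin (n + 1)} (h : ν k < ν j) :
    etaBar α ν j - etaBar α ν k ≠ 0 ∧ etaBar α ν j - etaBar α ν k ≠ 1 ∧
      etaBar α ν j - etaBar α ν k ≠ -1 := by
  obtain ⟨r, hr, e⟩ := Before.etaBar_sub α (Or.inl h : Before ν j k)
  rw [e]
  refine ⟨mul_add_ne_zero hα (Or.inr hr), fun e1 => ?_, fun e1 => ?_⟩
  · apply mul_add_ne_zero hα (m := ν j - ν k) (r := r - 1) (Or.inl (by omega))
    rw [Nat.cast_sub hr, Nat.cast_one]
    linear_combination e1
  · apply mul_add_ne_zero hα (m := ν j - ν k) (r := r + 1) (Or.inl (by omega))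
    rw [Nat.cast_add, Nat.cast_one]
    linear_combination e1

theorem etaBar_sub_ne' (hα : ∀ q : ℚ, q ≤ 0 → α ≠ (q : K)) {ν : Fin (n + 1) → ℕ}
    {j k : Fin (n + 1)} (h : ν j ≠ ν k) :
    etaBar α ν j - etaBar α ν k ≠ 0 ∧ etaBar α ν j - etaBar α ν k ≠ 1 ∧
      etaBar α ν j - etaBar α ν k ≠ -1 := by
  rcases lt_or_gt_of_ne h with h | h
  · obtain ⟨h0, h1, h2⟩ := etaBar_sub_ne hα h
    refine ⟨fun e => h0 ?_, fun e => h2 ?_, fun e => h1 ?_⟩ <;> linear_combination -e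
  · exact etaBar_sub_ne hα h

theorem etaBar_injective (hα : ∀ q : ℚ, q ≤ 0 → α ≠ (q : K)) (ν : Fin (n + 1) → ℕ)
    {i j : Fin (n + 1)} (h : etaBar α ν i = etaBar α ν j) : i = j := by
  by_contra hij
  rcases before_or_before ν hij with hb | hb
  all_goals
    obtain ⟨r, hr, e⟩ := hb.etaBar_sub α
    apply mul_add_ne_zero hα (Or.inr hr)
    rw [← e, h, sub_self]

/-- The spectral vector determines the composition. -/
theorem eq_comp_of_etaBar_eq (hα : ∀ q : ℚ, q ≤ 0 → α ≠ (q : K)) {μ ν : Fin (n + 1) → ℕ}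
    (w : Equiv.Perm (Fin (n + 1))) (h : ∀ i, etaBar α μ i = etaBar α ν (w i)) : μ = ν ∘ w := by
  -- If the two orders disagreed, one difference would equal both α m + r and -(α m' + r'), so that
  -- α(m + m') + (r + r') = 0. Hence `w` preserves ranks, which cancel and leave the parts.
  have key : ∀ j k, Before μ j k → ¬ Before ν (w k) (w j) := by
    intro j k h1 h2
    obtain ⟨r, hr, e⟩ := h1.etaBar_sub α
    obtain ⟨r', hr', e'⟩ := h2.etaBar_sub α
    rw [h, h] at e
    apply mul_add_ne_zero hα (m := (μ j - μ k) + (ν (w k) - ν (w j))) (r := r + r')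
      (Or.inr (by omega))
    push_cast
    linear_combination -e - e'
  have hb : ∀ j k, Before μ j k ↔ Before ν (w j) (w k) := by
    intro j k
    rcases eq_or_ne j k with rfl | hjk
    · simp [Before.irrefl]
    · constructor
      · intro h1
        exact (before_or_before ν (w.injective.ne hjk)).resolve_right (key j k h1)
      · intro h1
        exact (before_or_before μ hjk).resolve_right fun h2 => key k j h2 h1
  funext i
  have h1 := h i
  rw [etaBar_eq, etaBar_eq, rk_congr w fun k => hb k i] at h1
  have h2 : α * (μ i : K) = α * ν (w i) := by linear_combination h1
  exact_mod_cast mul_left_cancel₀ (alpha_ne_zero hα) h2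

end Rank

/-! ### Simple transpositions and spectral vectors. -/

section SimpleRefl

variable {n : ℕ} {K : Type*} [Field K] {α : K}

theorem simpleRefl_castSucc (i : Fin n) : simpleRefl i i.castSucc = i.succ :=
  Equiv.swap_apply_left _ _

theorem simpleRefl_succ (i : Fin n) : simpleRefl i i.succ = i.castSucc :=
  Equiv.swap_apply_right _ _

theorem simpleRefl_of_ne {i : Fin n} {j : Fin (n + 1)} (h1 : j ≠ i.castSucc) (h2 : j ≠ i.succ) :
    simpleRefl i j = j :=
  Equiv.swap_apply_of_ne_of_ne h1 h2

theorem simpleRefl_simpleRefl (i : Fin n) (j : Fin (n + 1)) :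
    simpleRefl i (simpleRefl i j) = j := by
  simp [simpleRefl]

theorem simpleRefl_mul_self (i : Fin n) : simpleRefl i * simpleRefl i = 1 := by
  simp [simpleRefl]

theorem simpleRefl_inv (i : Fin n) : (simpleRefl i)⁻¹ = simpleRefl i := by
  simp [simpleRefl]

theorem simpleRefl_lt_iff {i : Fin n} {j k : Fin (n + 1)}
    (h1 : ¬ (j = i.castSucc ∧ k = i.succ)) (h2 : ¬ (j = i.succ ∧ k = i.castSucc)) :
    simpleRefl i j < simpleRefl i k ↔ j < k := by
  simp only [simpleRefl, Equiv.swap_apply_def]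
  simp only [Fin.ext_iff, Fin.lt_def, Fin.val_castSucc, Fin.val_succ] at *
  split_ifs <;> simp only [Fin.val_castSucc, Fin.val_succ] <;> omega

/-- The swap reverses left and right only for the pair i, i + 1, and that matters for ranks only
when the two parts are equal. -/
theorem etaBar_comp_simpleRefl (i : Fin n) {ν : Fin (n + 1) → ℕ}
    (h : ν i.castSucc ≠ ν i.succ) (j : Fin (n + 1)) :
    etaBar α (ν ∘ simpleRefl i) j = etaBar α ν (simpleRefl i j) := by
  rw [etaBar_eq, etaBar_eq, Function.comp_apply]
  congr 2
  apply rk_congr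
  intro k
  by_cases h1 : j = i.castSucc ∧ k = i.succ
  · obtain ⟨rfl, rfl⟩ := h1
    simp only [Before, Function.comp_apply, simpleRefl_castSucc, simpleRefl_succ]; omega
  by_cases h2 : j = i.succ ∧ k = i.castSucc
  · obtain ⟨rfl, rfl⟩ := h2
    simp only [Before, Function.comp_apply, simpleRefl_castSucc, simpleRefl_succ]; omega
  simp only [Before, Function.comp_apply]
  rw [simpleRefl_lt_iff (fun h => h2 h.symm) (fun h => h1 h.symm)]

/-- Between two adjacent equal parts no other position can intervene in the ranking, so the ranks
are consecutive. -/
theorem etaBar_sub_of_eq (i : Fin n) {ν : Fin (n + 1) → ℕ}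
    (h : ν i.castSucc = ν i.succ) : etaBar α ν i.castSucc - etaBar α ν i.succ = 1 := by
  classical
  have : rk ν i.succ = rk ν i.castSucc + 1 := by
    have e : (Finset.univ.filter fun k => Before ν k i.succ) =
        insert i.castSucc (Finset.univ.filter fun k => Before ν k i.castSucc) := by
      ext k
      simp only [Finset.mem_insert, Finset.mem_filter, Finset.mem_univ, true_and, Before, h,
        Fin.lt_def, Fin.ext_iff, Fin.val_succ, Fin.val_castSucc]
      have h' : (k : ℕ) = i → ν k = ν i.succ := by
        intro hk
        have : k = i.castSucc := Fin.ext hk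
        rw [this, h]
      omega
    rw [rk, e, Finset.card_insert_of_notMem (by simp [Before.irrefl]), rk]
  rw [etaBar_eq, etaBar_eq, h, this]
  push_cast
  ring

end SimpleRefl

/-! ### Rotating a composition and raising its degree. -/

section Rotation

variable {n : ℕ} {K : Type*} [Field K] {α : K}

/-- The composition `(η_2, …, η_N, η_1 + 1)`. -/
def raise (η : Fin (n + 1) → ℕ) (i : Fin (n + 1)) : ℕ :=
  η (finRotate (n + 1) i) + if i = Fin.last n then 1 else 0

theorem finRotate_castSucc' (i : Fin n) : finRotate (n + 1) i.castSucc = i.succ := by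
  simp

/-- The ranking is unchanged: the part moved from the first to the last place loses its priority
among equals, and the added 1 restores it. -/
theorem etaBar_raise (η : Fin (n + 1) → ℕ) (i : Fin (n + 1)) :
    etaBar α (raise η) i =
      etaBar α η (finRotate (n + 1) i) + if i = Fin.last n then α else 0 := by
  have h : rk (raise η) i = rk η (finRotate (n + 1) i) := by
    apply rk_congr
    intro k
    induction i using Fin.lastCases with
    | last =>
      induction k using Fin.lastCases with
      | last => simp [Before.irrefl]
      | cast k =>
        simp only [Before, raise, finRotate_castSucc', finRotate_last, Fin.castSucc_ne_last,
          if_false, if_true, Fin.lt_def, Fin.val_zero, Fin.val_castSucc, Fin.val_last]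
        have := k.2
        omega
    | cast i =>
      induction k using Fin.lastCases with
      | last =>
        simp only [Before, raise, finRotate_castSucc', finRotate_last, Fin.castSucc_ne_last,
          if_false, if_true, Fin.lt_def, Fin.val_zero, Fin.val_castSucc, Fin.val_last,
          Fin.val_succ]
        have := i.2
        omega
      | cast k =>
        simp only [Before, raise, finRotate_castSucc', Fin.castSucc_ne_last,
          if_false, Fin.lt_def, Fin.val_castSucc, Fin.val_succ]
        omega
  rw [etaBar_eq, etaBar_eq, h, raise]
  split_ifs <;> push_cast <;> ring

end Rotation

/-! ### The dominance order and the order ≺. -/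

section Dominance

variable {n : ℕ}

theorem sum_sdiff_add_sum_inter {ι : Type*} [DecidableEq ι] (f : ι → ℕ) (S T : Finset ι) :
    ∑ x ∈ S \ T, f x + ∑ x ∈ S ∩ T, f x = ∑ x ∈ S, f x := by
  rw [← Finset.sdiff_inter_self_left, Finset.sum_sdiff Finset.inter_subset_left]

/-- Exchange argument: S outside the initial segment and the segment outside S have equal size, and
`f p` separates the values on them. -/
theorem sum_le_sum_Iic {f : Fin (n + 1) → ℕ} {S : Finset (Fin (n + 1))} {p : Fin (n + 1)}
    (hS : S.card = (Finset.Iic p).card) (h1 : ∀ x ∈ S, p < x → f x ≤ f p)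
    (h2 : ∀ x ∉ S, x ≤ p → f p ≤ f x) : ∑ x ∈ S, f x ≤ ∑ x ∈ Finset.Iic p, f x := by
  have hc : (S \ Finset.Iic p).card = (Finset.Iic p \ S).card := by
    have a := Finset.card_sdiff_add_card_inter S (Finset.Iic p)
    have b := Finset.card_sdiff_add_card_inter (Finset.Iic p) S
    rw [Finset.inter_comm] at b
    omega
  rw [← sum_sdiff_add_sum_inter f S (Finset.Iic p),
    ← sum_sdiff_add_sum_inter f (Finset.Iic p) S, Finset.inter_comm]
  apply Nat.add_le_add_right
  calc ∑ x ∈ S \ Finset.Iic p, f x ≤ (S \ Finset.Iic p).card • f p := by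
        apply Finset.sum_le_card_nsmul
        intro x hx
        simp only [Finset.mem_sdiff, Finset.mem_Iic, not_le] at hx
        exact h1 x hx.1 hx.2
    _ = (Finset.Iic p \ S).card • f p := by rw [hc]
    _ ≤ ∑ x ∈ Finset.Iic p \ S, f x := by
        apply Finset.card_nsmul_le_sum
        intro x hx
        simp only [Finset.mem_sdiff, Finset.mem_Iic] at hx
        exact h2 x hx.2 hx.1

theorem sortDesc_antitone (η : Fin (n + 1) → ℕ) : Antitone (sortDesc η) := by
  intro i j hij
  have := Tuple.monotone_sort (fun i => OrderDual.toDual (η i)) hij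
  exact this

theorem sum_sortDesc (η : Fin (n + 1) → ℕ) (g : ℕ → ℕ) :
    ∑ i, g (sortDesc η i) = ∑ i, g (η i) :=
  Equiv.sum_comp (Tuple.sort fun i => OrderDual.toDual (η i)) fun i => g (η i)

theorem sum_le_sum_sortDesc (η : Fin (n + 1) → ℕ) {S : Finset (Fin (n + 1))} {p : Fin (n + 1)}
    (hS : S.card = (Finset.Iic p).card) :
    ∑ x ∈ S, η x ≤ ∑ x ∈ Finset.Iic p, sortDesc η x := by
  set σ := Tuple.sort fun i => OrderDual.toDual (η i)
  have : ∑ x ∈ S, η x = ∑ x ∈ S.map σ.symm.toEmbedding, sortDesc η x := by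
    rw [Finset.sum_map]
    apply Finset.sum_congr rfl
    intro x _
    simp [sortDesc, σ]
  rw [this]
  apply sum_le_sum_Iic
  · rw [Finset.card_map, hS]
  · exact fun x _ h => sortDesc_antitone η h.le
  · exact fun x _ h => sortDesc_antitone η h

theorem exists_sum_eq_sum_sortDesc (η : Fin (n + 1) → ℕ) (p : Fin (n + 1)) :
    ∃ S : Finset (Fin (n + 1)), S.card = (Finset.Iic p).card ∧
      ∑ x ∈ S, η x = ∑ x ∈ Finset.Iic p, sortDesc η x := by
  refine ⟨(Finset.Iic p).map (Tuple.sort fun i => OrderDual.toDual (η i)).toEmbedding,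
    Finset.card_map _, ?_⟩
  rw [Finset.sum_map]
  rfl

/-- Partial sums of the decreasing rearrangement are the maximal sums over subsets of the given
size, so dominance can be tested on subsets without sorting. -/
theorem sum_Iic_sortDesc_le {ν η : Fin (n + 1) → ℕ}
    (h : ∀ S : Finset (Fin (n + 1)), ∃ T : Finset (Fin (n + 1)), T.card = S.card ∧
      ∑ x ∈ S, ν x ≤ ∑ x ∈ T, η x) (p : Fin (n + 1)) :
    ∑ x ∈ Finset.Iic p, sortDesc ν x ≤ ∑ x ∈ Finset.Iic p, sortDesc η x := by
  obtain ⟨S, hS, e⟩ := exists_sum_eq_sum_sortDesc ν p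
  obtain ⟨T, hT, hle⟩ := h S
  rw [← e]
  exact hle.trans (sum_le_sum_sortDesc η (hT.trans hS))

theorem sortDesc_comp_perm (η : Fin (n + 1) → ℕ) (w : Equiv.Perm (Fin (n + 1))) :
    sortDesc (η ∘ w) = sortDesc η := by
  have h := Tuple.comp_perm_comp_sort_eq_comp_sort (f := fun i => OrderDual.toDual (η i)) (σ := w)
  exact h

theorem eq_of_sum_Iic_eq {ν η : Fin (n + 1) → ℕ}
    (h : ∀ p, ∑ j ∈ Finset.Iic p, ν j = ∑ j ∈ Finset.Iic p, η j) : ν = η := by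
  have key : ∀ f : Fin (n + 1) → ℕ, ∀ i : Fin n,
      ∑ j ∈ Finset.Iic i.succ, f j = ∑ j ∈ Finset.Iic i.castSucc, f j + f i.succ := by
    intro f i
    have : Finset.Iic i.succ = insert i.succ (Finset.Iic i.castSucc) := by
      ext j
      simp only [Finset.mem_insert, Finset.mem_Iic, Fin.le_def, Fin.ext_iff, Fin.val_succ,
        Fin.val_castSucc]
      omega
    rw [this, Finset.sum_insert (by simp [Fin.le_def]), add_comm]
  funext i
  induction i using Fin.cases with
  | zero =>
    have h0 : Finset.Iic (0 : Fin (n + 1)) = {0} := by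
      ext j; simp
    simpa [h0] using h 0
  | succ i =>
    have h1 := h i.succ
    rw [key, key, h i.castSucc] at h1
    omega

theorem DomLT.trans {μ ν η : Fin (n + 1) → ℕ} (h1 : DomLT μ ν) (h2 : DomLT ν η) : DomLT μ η := by
  refine ⟨?_, h1.2.1.trans h2.2.1, fun p => (h1.2.2 p).trans (h2.2.2 p)⟩
  rintro rfl
  exact h1.1 (eq_of_sum_Iic_eq fun p => (h1.2.2 p).antisymm (h2.2.2 p))

theorem Prec.trans {μ ν η : Fin (n + 1) → ℕ} (h1 : Prec μ ν) (h2 : Prec ν η) : Prec μ η := by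
  rcases h1 with h1 | ⟨e1, h1⟩ <;> rcases h2 with h2 | ⟨e2, h2⟩
  · exact Or.inl (h1.trans h2)
  · exact Or.inl (e2 ▸ h1)
  · exact Or.inl (e1 ▸ h2)
  · exact Or.inr ⟨e1.trans e2, h1.trans h2⟩

theorem Prec.irrefl {η : Fin (n + 1) → ℕ} : ¬ Prec η η := by
  rintro (h | h)
  · exact h.1 rfl
  · exact h.2.1 rfl

theorem Prec.asymm {ν η : Fin (n + 1) → ℕ} (h : Prec ν η) : ¬ Prec η ν :=
  fun h' => Prec.irrefl (h.trans h')

theorem exists_prec_maximal {s : Finset (Fin (n + 1) → ℕ)} (hs : s.Nonempty) :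
    ∃ η ∈ s, ∀ ν ∈ s, ¬ Prec η ν := by
  have : IsTrans (Fin (n + 1) → ℕ) (Function.swap Prec) := ⟨fun _ _ _ h1 h2 => h2.trans h1⟩
  have : Std.Irrefl (α := Fin (n + 1) → ℕ) (Function.swap Prec) := ⟨fun _ => Prec.irrefl⟩
  have : IsStrictOrder (Fin (n + 1) → ℕ) (Function.swap Prec) := {}
  have hw := s.finite_toSet.wellFoundedOn (r := Function.swap Prec)
  obtain ⟨η, hη, hmax⟩ := hw.has_min (s := Set.univ) ⟨⟨_, hs.choose_spec⟩, trivial⟩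
  exact ⟨η, η.2, fun ν hν => hmax ⟨ν, hν⟩ trivial⟩

/-- Moving two parts strictly towards each other gives a smaller composition. -/
theorem prec_of_squeeze {ν η : Fin (n + 1) → ℕ} {u v : Fin (n + 1)} (huv : u ≠ v)
    (h : ∀ j, j ≠ u → j ≠ v → ν j = η j) (hs : ν u + ν v = η u + η v)
    (hu : ν u < η u) (hv : ν v < η u) : Prec ν η := by
  have hsum : ∀ g : ℕ → ℕ, ∀ S : Finset (Fin (n + 1)), (∀ j ∈ S, j ≠ u ∧ j ≠ v) →
      ∑ j ∈ S, g (ν j) = ∑ j ∈ S, g (η j) := fun g S hS =>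
    Finset.sum_congr rfl fun j hj => by rw [h j (hS j hj).1 (hS j hj).2]
  have htot : ∀ g : ℕ → ℕ, ∀ f : Fin (n + 1) → ℕ,
      ∑ j, g (f j) = g (f u) + g (f v) + ∑ j ∈ (Finset.univ.erase u).erase v, g (f j) := by
    intro g f
    rw [← Finset.add_sum_erase _ _ (Finset.mem_univ u),
      ← Finset.add_sum_erase (Finset.univ.erase u) _ (a := v) (by simp [huv.symm]), add_assoc]
  have herase : ∀ j ∈ (Finset.univ.erase u).erase v, j ≠ u ∧ j ≠ v := by
    intro j hj
    simp only [Finset.mem_erase] at hj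
    exact ⟨hj.2.1, hj.1⟩
  left
  refine ⟨fun e => ?_, ?_, sum_Iic_sortDesc_le fun S => ?_⟩
  -- Strictness: squeezing strictly lowers the sum of squares, which is invariant under
  -- rearrangement.
  · have h1 := sum_sortDesc ν (fun x => x * x)
    rw [e, sum_sortDesc η (fun x => x * x), htot (fun x => x * x) η, htot (fun x => x * x) ν,
      hsum (fun x => x * x) _ herase] at h1
    have h2 : η u * η u + η v * η v = ν u * ν u + ν v * ν v := by
      simpa using h1
    obtain ⟨x, hx⟩ := Nat.exists_eq_add_of_lt hu
    obtain ⟨y, hy⟩ := Nat.exists_eq_add_of_lt hv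
    have h3 : ν v = η v + x + 1 := by omega
    nlinarith
  · refine (sum_sortDesc ν id).trans (Eq.trans ?_ (sum_sortDesc η id).symm)
    rw [htot id ν, htot id η, hsum id _ herase]
    simp only [id, hs]
  · by_cases huS : u ∈ S <;> by_cases hvS : v ∈ S
    · refine ⟨S, rfl, ?_⟩
      rw [← Finset.add_sum_erase _ _ huS,
        ← Finset.add_sum_erase (S.erase u) _ (a := v) (by simp [huv.symm, hvS]),
        ← Finset.add_sum_erase _ η huS,
        ← Finset.add_sum_erase (S.erase u) η (a := v) (by simp [huv.symm, hvS]),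
        show ∑ x ∈ (S.erase u).erase v, ν x = ∑ x ∈ (S.erase u).erase v, η x from
          hsum id _ (by
          intro j hj
          simp only [Finset.mem_erase] at hj
          exact ⟨hj.2.1, hj.1⟩)]
      omega
    · refine ⟨S, rfl, Finset.sum_le_sum fun j hj => ?_⟩
      rcases eq_or_ne j u with rfl | hju
      · exact hu.le
      · exact (h j hju (fun e => hvS (e ▸ hj))).le
    -- The part of ν at v may exceed that of η at v, but it is below `η u`; hence v is traded for u.
    · refine ⟨insert u (S.erase v), ?_, ?_⟩
      · rw [Finset.card_insert_of_notMem (by simp [huS]), Finset.card_erase_add_one hvS]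
      · rw [Finset.sum_insert (by simp [huS]), ← Finset.add_sum_erase _ _ hvS,
          show ∑ x ∈ S.erase v, ν x = ∑ x ∈ S.erase v, η x from hsum id _ (by
            intro j hj
            simp only [Finset.mem_erase] at hj
            exact ⟨fun e => huS (e ▸ hj.2), hj.1⟩)]
        omega
    · exact ⟨S, rfl, (hsum id S fun j hj =>
        ⟨fun e => huS (e ▸ hj), fun e => hvS (e ▸ hj)⟩).le⟩

/-- A permutation of a composition which is, at each cut, at most the composition itself. -/
theorem prec_comp_perm {η : Fin (n + 1) → ℕ} (w : Equiv.Perm (Fin (n + 1)))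
    (h : ∀ x p : Fin (n + 1), x ≤ p → p < w x → η (w x) ≤ η p)
    (h' : ∀ x p : Fin (n + 1), p < x → w x ≤ p → η p ≤ η (w x)) (hne : η ∘ w ≠ η) :
    Prec (η ∘ w) η := by
  refine Or.inr ⟨sortDesc_comp_perm η w, hne, Equiv.sum_comp w η, fun p => ?_⟩
  have : ∑ j ∈ Finset.Iic p, (η ∘ w) j = ∑ j ∈ (Finset.Iic p).map w.toEmbedding, η j := by
    rw [Finset.sum_map]; rfl
  rw [this]
  apply sum_le_sum_Iic (Finset.card_map _)
  · intro x hx hpx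
    simp only [Finset.mem_map, Finset.mem_Iic] at hx
    obtain ⟨y, hy, rfl⟩ := hx
    exact h y p hy hpx
  · intro x hx hxp
    have hp : p < w.symm x := by
      by_contra hc
      exact hx (Finset.mem_map.mpr ⟨w.symm x, by simpa using hc, by simp⟩)
    have := h' (w.symm x) p hp (by simpa using hxp)
    simpa using this

/-- Cuts at or after v see the same set of parts; earlier cuts see at most the decrease at u. -/
theorem prec_swap {η : Fin (n + 1) → ℕ} {u v : Fin (n + 1)} (huv : u < v) (h : η v < η u) :
    Prec (η ∘ Equiv.swap u v) η := by
  refine Or.inr ⟨sortDesc_comp_perm η _, ?_, Equiv.sum_comp (Equiv.swap u v) η, fun p => ?_⟩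
  · intro e
    have := congrFun e u
    simp only [Function.comp_apply, Equiv.swap_apply_left] at this
    omega
  · by_cases hv : v ≤ p
    · apply le_of_eq
      have : (Finset.Iic p).map (Equiv.swap u v).toEmbedding = Finset.Iic p := by
        apply Finset.eq_of_subset_of_card_le
        · intro x hx
          simp only [Finset.mem_map, Finset.mem_Iic] at hx ⊢
          obtain ⟨y, hy, rfl⟩ := hx
          simp only [Equiv.coe_toEmbedding, Equiv.swap_apply_def]
          split_ifs
          · exact hv
          · exact huv.le.trans hv
          · exact hy
        · rw [Finset.card_map]
      conv_rhs => rw [← this]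
      rw [Finset.sum_map]
      rfl
    · apply Finset.sum_le_sum
      intro j hj
      rw [Finset.mem_Iic] at hj
      rcases eq_or_ne j u with rfl | hju
      · simpa using h.le
      · rw [Function.comp_apply, Equiv.swap_apply_of_ne_of_ne hju]
        rintro rfl
        exact hv hj

end Dominance

end PrescribedJack

namespace PrescribedJack

/-! ### Commutation of the ξ_i with permutations and with the raising operator. -/

section Relations

variable {K : Type*} [Field K] {n : ℕ}

theorem permAct_mul (w : Equiv.Perm (Fin (n + 1))) (f g : MvPolynomial (Fin (n + 1)) K) :
    permAct w (f * g) = permAct w f * permAct w g :=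
  map_mul (rename w) f g

theorem permAct_X (w : Equiv.Perm (Fin (n + 1))) (i : Fin (n + 1)) :
    permAct w (X i : MvPolynomial (Fin (n + 1)) K) = X (w i) :=
  rename_X _ _

theorem permAct_permAct (v w : Equiv.Perm (Fin (n + 1))) (f : MvPolynomial (Fin (n + 1)) K) :
    permAct v (permAct w f) = permAct (v * w) f :=
  rename_rename _ _ _

theorem permAct_one (f : MvPolynomial (Fin (n + 1)) K) : permAct 1 f = f :=
  rename_id_apply f

theorem permAct_simpleRefl_self (i : Fin n) (f : MvPolynomial (Fin (n + 1)) K) :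
    permAct (simpleRefl i) (permAct (simpleRefl i) f) = f := by
  rw [permAct_permAct, simpleRefl_mul_self, permAct_one]

theorem permAct_injective (w : Equiv.Perm (Fin (n + 1))) :
    Function.Injective (permAct w : MvPolynomial (Fin (n + 1)) K →ₗ[K] _) :=
  rename_injective _ w.injective

theorem X_sub_X_ne_zero {i p : Fin (n + 1)} (h : i ≠ p) :
    (X i - X p : MvPolynomial (Fin (n + 1)) K) ≠ 0 :=
  fun e => h (X_injective (sub_eq_zero.mp e))

theorem divDiff_self (i : Fin (n + 1)) :
    (divDiff i i : MvPolynomial (Fin (n + 1)) K →ₗ[K] _) = 0 := by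
  rw [divDiff, dif_pos rfl]

theorem divDiff_eq_of_mul_eq {i p : Fin (n + 1)} (h : i ≠ p)
    {f q : MvPolynomial (Fin (n + 1)) K}
    (hq : (X i - X p) * q = f - permAct (Equiv.swap i p) f) : divDiff i p f = q :=
  mul_left_cancel₀ (X_sub_X_ne_zero h) ((divDiff_spec h f).trans hq.symm)

theorem divDiff_comm (i p : Fin (n + 1)) (f : MvPolynomial (Fin (n + 1)) K) :
    divDiff i p f = -divDiff p i f := by
  rcases eq_or_ne i p with rfl | h
  · simp [divDiff_self]
  · apply divDiff_eq_of_mul_eq h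
    rw [Equiv.swap_comm, ← divDiff_spec h.symm]
    ring

theorem permAct_divDiff (w : Equiv.Perm (Fin (n + 1))) (i p : Fin (n + 1))
    (f : MvPolynomial (Fin (n + 1)) K) :
    permAct w (divDiff i p f) = divDiff (w i) (w p) (permAct w f) := by
  rcases eq_or_ne i p with rfl | h
  · simp [divDiff_self]
  · symm
    apply divDiff_eq_of_mul_eq (w.injective.ne h)
    have := congrArg (permAct w) (divDiff_spec h f)
    rw [permAct_mul, map_sub, map_sub, permAct_X, permAct_X, permAct_permAct,
      Equiv.mul_swap_eq_swap_mul, ← permAct_permAct] at this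
    exact this

theorem permAct_pderiv (w : Equiv.Perm (Fin (n + 1))) (i : Fin (n + 1))
    (f : MvPolynomial (Fin (n + 1)) K) :
    permAct w (pderiv i f) = pderiv (w i) (permAct w f) :=
  (pderiv_rename w.injective i f).symm

/-- Writing the numerator as the variable of index `max i p` merges the two sums (the term p = i is
0), so conjugation by a permutation only has to track maxima. -/
theorem xi_apply (α : K) (i : Fin (n + 1)) (f : MvPolynomial (Fin (n + 1)) K) :
    xi α i f = α • (X i * pderiv i f) + ∑ p, X (max i p) * divDiff i p f - (i : K) • f := by
  have h : ∑ p, X (max i p) * divDiff i p f =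
      ∑ p ∈ Finset.Iio i, X i * divDiff i p f + ∑ p ∈ Finset.Ioi i, X p * divDiff i p f := by
    have hu : (Finset.univ : Finset (Fin (n + 1))) =
        insert i (Finset.Iio i ∪ Finset.Ioi i) := by
      ext p
      simp only [Finset.mem_univ, Finset.mem_insert, Finset.mem_union, Finset.mem_Iio,
        Finset.mem_Ioi, true_iff]
      omega
    rw [hu, Finset.sum_insert (by simp), divDiff_self, LinearMap.zero_apply, mul_zero, zero_add,
      Finset.sum_union]
    · congr 1
      · apply Finset.sum_congr rfl
        intro p hp
        rw [max_eq_left (Finset.mem_Iio.mp hp).le]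
      · apply Finset.sum_congr rfl
        intro p hp
        rw [max_eq_right (Finset.mem_Ioi.mp hp).le]
    · rw [Finset.disjoint_left]
      intro p hp hp'
      simp only [Finset.mem_Iio, Finset.mem_Ioi] at hp hp'
      omega
  rw [h]
  simp [xi, LinearMap.sum_apply, add_assoc]

theorem permAct_xi (α : K) (w : Equiv.Perm (Fin (n + 1))) (i : Fin (n + 1))
    (f : MvPolynomial (Fin (n + 1)) K) :
    permAct w (xi α i f) = α • (X (w i) * pderiv (w i) (permAct w f)) +
      ∑ p, X (w (max i p)) * divDiff (w i) (w p) (permAct w f) - (i : K) • permAct w f := by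
  simp only [xi_apply, map_sub, map_add, map_sum, permAct_mul, permAct_X, permAct_divDiff,
    permAct_pderiv, map_smul]

theorem permAct_simpleRefl_xi_of_ne (α : K) (i : Fin n) {j : Fin (n + 1)}
    (h1 : j ≠ i.castSucc) (h2 : j ≠ i.succ) (f : MvPolynomial (Fin (n + 1)) K) :
    permAct (simpleRefl i) (xi α j f) = xi α j (permAct (simpleRefl i) f) := by
  rw [permAct_xi, xi_apply, simpleRefl_of_ne h1 h2, ← Equiv.sum_comp (simpleRefl i)]
  congr 2
  apply Finset.sum_congr rfl
  intro p _
  rw [simpleRefl_simpleRefl]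
  congr 2
  have hj := simpleRefl_of_ne h1 h2
  have hlt := simpleRefl_lt_iff (i := i) (j := j) (k := p) (fun h => h1 h.1) (fun h => h2 h.1)
  rw [hj] at hlt
  rcases lt_or_ge j (simpleRefl i p) with h | h
  · rw [max_eq_right h.le, simpleRefl_simpleRefl, max_eq_right (hlt.mp h).le]
  · rw [max_eq_left h, hj, max_eq_left (not_lt.mp fun h' => h.not_gt (hlt.mpr h'))]

/-- Only the term pairing i with i + 1 has its maximum changed, which contributes f - s_i f; the
additive constants of ξ_i and ξ_{i+1} differ by 1 and contribute the missing s_i f. -/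
theorem permAct_simpleRefl_xi_castSucc (α : K) (i : Fin n) (f : MvPolynomial (Fin (n + 1)) K) :
    permAct (simpleRefl i) (xi α i.castSucc f) =
      xi α i.succ (permAct (simpleRefl i) f) + f := by
  set g := permAct (simpleRefl i) f with hg
  have hf : f = permAct (simpleRefl i) g := by rw [hg, permAct_simpleRefl_self]
  have hne : i.castSucc ≠ i.succ := by simp [Fin.ext_iff]
  have key : ∑ p, X (simpleRefl i (max i.castSucc p)) *
        divDiff (simpleRefl i i.castSucc) (simpleRefl i p) g =
      ∑ p, X (max i.succ p) * divDiff i.succ p g + (f - g) := by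
    rw [← Equiv.sum_comp (simpleRefl i),
      ← Finset.add_sum_erase _ _ (Finset.mem_univ i.castSucc),
      ← Finset.add_sum_erase _ (fun p => X (max i.succ p) * divDiff i.succ p g)
        (Finset.mem_univ i.castSucc)]
    have h1 : ∑ p ∈ Finset.univ.erase i.castSucc,
          X (simpleRefl i (max i.castSucc (simpleRefl i p))) *
            divDiff (simpleRefl i i.castSucc) (simpleRefl i (simpleRefl i p)) g =
        ∑ p ∈ Finset.univ.erase i.castSucc, X (max i.succ p) * divDiff i.succ p g := by
      apply Finset.sum_congr rfl
      intro p hp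
      rw [Finset.mem_erase] at hp
      rw [simpleRefl_simpleRefl, simpleRefl_castSucc]
      rcases eq_or_ne p i.succ with rfl | hp2
      · simp [divDiff_self]
      rw [simpleRefl_of_ne hp.1 hp2]
      congr 2
      rcases lt_or_ge p i.castSucc with h | h
      · rw [max_eq_left h.le, simpleRefl_castSucc, max_eq_left]
        simp only [Fin.le_def, Fin.lt_def, Fin.val_castSucc, Fin.val_succ] at *
        omega
      · rw [max_eq_right h, simpleRefl_of_ne hp.1 hp2, max_eq_right]
        have := hp.1
        simp only [ne_eq, Fin.ext_iff, Fin.le_def, Fin.val_castSucc, Fin.val_succ] at *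
        omega
    rw [h1, simpleRefl_simpleRefl, simpleRefl_castSucc]
    have h2 := divDiff_spec hne.symm g
    rw [Equiv.swap_comm, show Equiv.swap i.castSucc i.succ = simpleRefl i from rfl, ← hf] at h2
    have h3 : max i.castSucc i.succ = i.succ := max_eq_right (by simp [Fin.le_def])
    rw [h3, max_comm, h3, simpleRefl_succ]
    linear_combination -h2
  rw [permAct_xi, ← hg, key, xi_apply, simpleRefl_castSucc, Fin.val_succ, Fin.val_castSucc]
  push_cast
  simp only [smul_eq_C_mul, map_add, map_one]
  ring

theorem permAct_simpleRefl_xi_succ (α : K) (i : Fin n) (f : MvPolynomial (Fin (n + 1)) K) :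
    permAct (simpleRefl i) (xi α i.succ f) =
      xi α i.castSucc (permAct (simpleRefl i) f) - f := by
  have h := permAct_simpleRefl_xi_castSucc α i (permAct (simpleRefl i) f)
  rw [permAct_simpleRefl_self] at h
  have h2 := congrArg (permAct (simpleRefl i)) h
  rw [permAct_simpleRefl_self, map_add, permAct_simpleRefl_self] at h2
  rw [h2, add_sub_cancel_right]

/-- The operator `f ↦ z_N f(z_N, z_1, …, z_{N-1})`, which maps `z^η` to
`z^(η_2, …, η_N, η_1 + 1)`. -/
noncomputable def raiseOp : Module.End K (MvPolynomial (Fin (n + 1)) K) :=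
  LinearMap.mulLeft K (X (Fin.last n)) ∘ₗ permAct (finRotate (n + 1))⁻¹

theorem raiseOp_apply (f : MvPolynomial (Fin (n + 1)) K) :
    raiseOp f = X (Fin.last n) * permAct (finRotate (n + 1))⁻¹ f := rfl

theorem raiseOp_injective :
    Function.Injective (raiseOp : Module.End K (MvPolynomial (Fin (n + 1)) K)) := by
  intro f g h
  rw [raiseOp_apply, raiseOp_apply] at h
  exact permAct_injective _ (mul_left_cancel₀ (X_ne_zero _) h)

theorem divDiff_X_mul {i p l : Fin (n + 1)} (h1 : l ≠ i) (h2 : l ≠ p)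
    (g : MvPolynomial (Fin (n + 1)) K) : divDiff i p (X l * g) = X l * divDiff i p g := by
  rcases eq_or_ne i p with rfl | h
  · simp [divDiff_self]
  · apply divDiff_eq_of_mul_eq h
    rw [permAct_mul, permAct_X, Equiv.swap_apply_of_ne_of_ne h1 h2]
    linear_combination X l * divDiff_spec h g

theorem divDiff_X_mul_right {i p : Fin (n + 1)} (h : i ≠ p)
    (g : MvPolynomial (Fin (n + 1)) K) :
    divDiff i p (X p * g) = X i * divDiff i p g - g := by
  apply divDiff_eq_of_mul_eq h
  rw [permAct_mul, permAct_X, Equiv.swap_apply_right]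
  linear_combination X i * divDiff_spec h g

theorem divDiff_X_mul_left {i p : Fin (n + 1)} (h : i ≠ p)
    (g : MvPolynomial (Fin (n + 1)) K) :
    divDiff i p (X i * g) = X p * divDiff i p g + g := by
  apply divDiff_eq_of_mul_eq h
  rw [permAct_mul, permAct_X, Equiv.swap_apply_left]
  linear_combination X p * divDiff_spec h g

/-- The factor z_N passes through every divided difference except the one with p = N; the correction
there accounts for the additive constants of ξ_i and ξ_{i+1}. -/
theorem xi_raiseOp_castSucc (α : K) (i : Fin n) (f : MvPolynomial (Fin (n + 1)) K) :
    xi α i.castSucc (raiseOp f) = raiseOp (xi α i.succ f) := by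
  have hlast : i.castSucc ≠ Fin.last n := Fin.castSucc_ne_last i
  have hrot : ∀ j : Fin n, (finRotate (n + 1))⁻¹ j.succ = j.castSucc := fun j => by
    rw [Equiv.Perm.inv_eq_iff_eq, finRotate_castSucc']
  have hrot0 : (finRotate (n + 1))⁻¹ 0 = Fin.last n := by
    rw [Equiv.Perm.inv_eq_iff_eq, finRotate_last]
  rw [raiseOp_apply, raiseOp_apply, permAct_xi, xi_apply]
  set g := permAct (finRotate (n + 1))⁻¹ f
  rw [hrot, Fin.sum_univ_castSucc, Fin.sum_univ_succ]
  have h1 : ∀ p : Fin n, X (max i.castSucc p.castSucc) *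
      divDiff i.castSucc p.castSucc (X (Fin.last n) * g) =
      X (Fin.last n) * (X ((finRotate (n + 1))⁻¹ (max i.succ p.succ)) *
        divDiff i.castSucc ((finRotate (n + 1))⁻¹ p.succ) g) := by
    intro p
    have hm : max i.succ p.succ = (max i p).succ := (Fin.strictMono_succ.monotone.map_max).symm
    have hm' : max i.castSucc p.castSucc = (max i p).castSucc :=
      (Fin.strictMono_castSucc.monotone.map_max).symm
    rw [hm, hm', hrot, hrot, divDiff_X_mul (Fin.castSucc_ne_last _).symm
      (Fin.castSucc_ne_last _).symm]
    ring
  rw [Finset.sum_congr rfl fun p _ => h1 p, ← Finset.mul_sum, hrot0,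
    max_eq_right (Fin.le_last _), max_eq_left (Fin.zero_le _), hrot,
    divDiff_X_mul_right hlast, Derivation.leibniz, pderiv_X_of_ne hlast.symm,
    Fin.val_succ, Fin.val_castSucc]
  push_cast
  simp only [smul_eq_C_mul, map_add, map_one, smul_eq_mul]
  ring

/-- Each of the N - 1 divided differences yields one extra copy, cancelling the constant 1 - N of
ξ_N; differentiating the factor z_N yields α. -/
theorem xi_raiseOp_last (α : K) (f : MvPolynomial (Fin (n + 1)) K) :
    xi α (Fin.last n) (raiseOp f) = raiseOp (xi α 0 f) + α • raiseOp f := by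
  have hrot : ∀ j : Fin n, (finRotate (n + 1))⁻¹ j.succ = j.castSucc := fun j => by
    rw [Equiv.Perm.inv_eq_iff_eq, finRotate_castSucc']
  have hrot0 : (finRotate (n + 1))⁻¹ 0 = Fin.last n := by
    rw [Equiv.Perm.inv_eq_iff_eq, finRotate_last]
  rw [raiseOp_apply, raiseOp_apply, permAct_xi, xi_apply]
  set g := permAct (finRotate (n + 1))⁻¹ f
  rw [hrot0, Fin.sum_univ_castSucc, Fin.sum_univ_succ]
  have h1 : ∀ p : Fin n, X (max (Fin.last n) p.castSucc) *
      divDiff (Fin.last n) p.castSucc (X (Fin.last n) * g) =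
      X (Fin.last n) * (X ((finRotate (n + 1))⁻¹ (max 0 p.succ)) *
        divDiff (Fin.last n) ((finRotate (n + 1))⁻¹ p.succ) g) + X (Fin.last n) * g := by
    intro p
    rw [max_eq_left (Fin.le_last _), max_eq_right (Fin.zero_le _), hrot,
      divDiff_X_mul_left (Fin.castSucc_ne_last _).symm]
    ring
  rw [Finset.sum_congr rfl fun p _ => h1 p, Finset.sum_add_distrib, ← Finset.mul_sum,
    Finset.sum_const, Finset.card_univ, Fintype.card_fin, hrot0, divDiff_self,
    Derivation.leibniz, pderiv_X_self, Fin.val_zero, Fin.val_last]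
  simp only [smul_eq_C_mul, smul_eq_mul, LinearMap.zero_apply, nsmul_eq_mul, map_natCast,
    Nat.cast_zero, map_zero]
  ring

end Relations

end PrescribedJack

namespace PrescribedJack

/-! ### Triangularity of the ξ_i on monomials. -/

section Triangular

variable {K : Type*} [Field K] {n : ℕ}

/-- The monomial `z^η`. -/
noncomputable def mono (η : Fin (n + 1) → ℕ) : MvPolynomial (Fin (n + 1)) K :=
  monomial (Finsupp.equivFunOnFinite.symm η) 1

/-- The coefficient of `z^ν`. -/
noncomputable def coef (ν : Fin (n + 1) → ℕ) : MvPolynomial (Fin (n + 1)) K →ₗ[K] K :=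
  lcoeff K (Finsupp.equivFunOnFinite.symm ν)

theorem coef_apply (ν : Fin (n + 1) → ℕ) (f : MvPolynomial (Fin (n + 1)) K) :
    coef ν f = coeff (Finsupp.equivFunOnFinite.symm ν) f := rfl

theorem coef_mono (ν η : Fin (n + 1) → ℕ) :
    coef ν (mono η : MvPolynomial (Fin (n + 1)) K) = if η = ν then 1 else 0 := by
  rw [coef_apply, mono, coeff_monomial]
  simp only [EmbeddingLike.apply_eq_iff_eq]

theorem eq_sum_coef_smul_mono (f : MvPolynomial (Fin (n + 1)) K) :
    f = ∑ d ∈ f.support, coef ⇑d f • mono ⇑d := by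
  conv_lhs => rw [← f.support_sum_monomial_coeff]
  apply Finset.sum_congr rfl
  intro d _
  rw [coef_apply, mono, Finsupp.equivFunOnFinite_symm_coe, smul_monomial, smul_eq_mul, mul_one]

theorem exists_coef_ne_zero {f : MvPolynomial (Fin (n + 1)) K} (hf : f ≠ 0) :
    ∃ ν, coef ν f ≠ 0 := by
  obtain ⟨d, hd⟩ := ne_zero_iff.mp hf
  exact ⟨⇑d, by rwa [coef_apply, Finsupp.equivFunOnFinite_symm_coe]⟩

theorem permAct_mono (w : Equiv.Perm (Fin (n + 1))) (η : Fin (n + 1) → ℕ) :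
    permAct w (mono η : MvPolynomial (Fin (n + 1)) K) = mono (η ∘ ⇑w⁻¹) := by
  rw [mono, permAct, AlgHom.toLinearMap_apply, rename_monomial, mono]
  refine congrArg (fun d => monomial d (1 : K)) ?_
  ext j
  obtain ⟨i, rfl⟩ := w.surjective j
  rw [Finsupp.mapDomain_apply w.injective]
  simp

theorem coef_permAct (w : Equiv.Perm (Fin (n + 1))) (ν : Fin (n + 1) → ℕ)
    (f : MvPolynomial (Fin (n + 1)) K) : coef ν (permAct w f) = coef (ν ∘ w) f := by
  rw [coef_apply, coef_apply, permAct, AlgHom.toLinearMap_apply,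
    ← coeff_rename_mapDomain w w.injective f]
  refine congrArg (fun d => coeff d (rename w f)) ?_
  ext j
  obtain ⟨i, rfl⟩ := w.surjective j
  rw [Finsupp.mapDomain_apply w.injective]
  simp

theorem X_mul_mono (u : Fin (n + 1)) (η : Fin (n + 1) → ℕ) :
    (X u * mono η : MvPolynomial (Fin (n + 1)) K) = mono (Function.update η u (η u + 1)) := by
  rw [mono, X, monomial_mul, mono, one_mul]
  refine congrArg (fun d => monomial d (1 : K)) ?_
  ext j
  rcases eq_or_ne j u with rfl | h
  · simp [add_comm]
  · simp [h]

/-- The exponents that appear in the divided difference of `z^η`. -/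
def between (η : Fin (n + 1) → ℕ) (u v : Fin (n + 1)) (c : ℕ) : Fin (n + 1) → ℕ :=
  Function.update (Function.update η u (η v + c)) v (η u - c)

theorem X_mul_mono_between {η : Fin (n + 1) → ℕ} {u v : Fin (n + 1)} (huv : u ≠ v) {c : ℕ}
    (hc : c < η u - η v) :
    (X u * mono (between η u v c) : MvPolynomial (Fin (n + 1)) K) =
      X v * mono (between η u v (c + 1)) := by
  rw [X_mul_mono, X_mul_mono]
  congr 1
  funext j
  simp only [between, Function.update_apply]
  split_ifs <;> omega

theorem between_zero {η : Fin (n + 1) → ℕ} {u v : Fin (n + 1)} :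
    between η u v 0 = η ∘ Equiv.swap u v := by
  funext j
  simp only [between, Function.update_apply, Function.comp_apply, Equiv.swap_apply_def]
  split_ifs <;> simp_all

theorem between_sub {η : Fin (n + 1) → ℕ} {u v : Fin (n + 1)} (h : η v < η u) :
    between η u v (η u - η v) = η := by
  funext j
  simp only [between, Function.update_apply]
  split_ifs with h1 h2
  · subst h1; omega
  · subst h2; omega
  · rfl

theorem prec_between {η : Fin (n + 1) → ℕ} {u v : Fin (n + 1)} (huv : u ≠ v) {c : ℕ}
    (h0 : 0 < c) (hc : c < η u - η v) : Prec (between η u v c) η := by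
  apply prec_of_squeeze huv
  · intro j h1 h2
    simp [between, h1, h2]
  all_goals
    simp only [between, Function.update_self, Function.update_of_ne huv]
    omega

/-- A telescoping geometric sum. This one ends in z^η itself; its companion with the other variable
starts with the swapped monomial instead. -/
theorem X_left_mul_divDiff_mono {η : Fin (n + 1) → ℕ} {u v : Fin (n + 1)} (huv : u ≠ v)
    (h : η v < η u) : (X u * divDiff u v (mono η) : MvPolynomial (Fin (n + 1)) K) =
      ∑ c ∈ Finset.range (η u - η v), mono (between η u v (c + 1)) := by
  apply mul_left_cancel₀ (X_sub_X_ne_zero huv)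
  rw [mul_left_comm, divDiff_spec huv, permAct_mono, Equiv.swap_inv, ← between_zero (u := u)]
  have : ∀ c ∈ Finset.range (η u - η v),
      ((X u - X v) * mono (between η u v (c + 1)) : MvPolynomial (Fin (n + 1)) K) =
        X u * mono (between η u v (c + 1)) - X u * mono (between η u v c) := by
    intro c hc
    rw [X_mul_mono_between huv (Finset.mem_range.mp hc)]
    ring
  rw [Finset.mul_sum, Finset.sum_congr rfl this,
    Finset.sum_range_sub fun c => X u * mono (between η u v c), between_sub h]
  ring

theorem X_right_mul_divDiff_mono {η : Fin (n + 1) → ℕ} {u v : Fin (n + 1)} (huv : u ≠ v)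
    (h : η v < η u) : (X v * divDiff u v (mono η) : MvPolynomial (Fin (n + 1)) K) =
      ∑ c ∈ Finset.range (η u - η v), mono (between η u v c) := by
  apply mul_left_cancel₀ (X_sub_X_ne_zero huv)
  rw [mul_left_comm, divDiff_spec huv, permAct_mono, Equiv.swap_inv, ← between_zero (u := u)]
  have : ∀ c ∈ Finset.range (η u - η v),
      ((X u - X v) * mono (between η u v c) : MvPolynomial (Fin (n + 1)) K) =
        X v * mono (between η u v (c + 1)) - X v * mono (between η u v c) := by
    intro c hc
    rw [← X_mul_mono_between huv (Finset.mem_range.mp hc)]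
    ring
  rw [Finset.mul_sum, Finset.sum_congr rfl this,
    Finset.sum_range_sub fun c => X v * mono (between η u v c), between_sub h]
  ring

/-- The polynomials all of whose exponents are smaller than `η`. -/
noncomputable def lower (K : Type*) [Field K] (η : Fin (n + 1) → ℕ) :
    Submodule K (MvPolynomial (Fin (n + 1)) K) where
  carrier := {f | ∀ ν, ¬ Prec ν η → coef ν f = 0}
  add_mem' hf hg ν hν := by rw [map_add, hf ν hν, hg ν hν, add_zero]
  zero_mem' ν _ := map_zero _
  smul_mem' c f hf ν hν := by rw [map_smul, hf ν hν, smul_zero]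

theorem mono_mem_lower {ν η : Fin (n + 1) → ℕ} (h : Prec ν η) : mono ν ∈ lower K η := by
  intro μ hμ
  rw [coef_mono, if_neg]
  rintro rfl
  exact hμ h

theorem X_left_mul_divDiff_mono_sub_mem {η : Fin (n + 1) → ℕ} {u v : Fin (n + 1)} (huv : u ≠ v)
    (h : η v < η u) : X u * divDiff u v (mono η) - mono η ∈ lower K η := by
  obtain ⟨m, hm⟩ : ∃ m, η u - η v = m + 1 := ⟨η u - η v - 1, by omega⟩
  rw [X_left_mul_divDiff_mono huv h, hm, Finset.sum_range_succ, ← hm, between_sub h,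
    add_sub_cancel_right]
  refine Submodule.sum_mem _ fun c hc => mono_mem_lower (prec_between huv (by omega) ?_)
  rw [Finset.mem_range] at hc
  omega

theorem X_right_mul_divDiff_mono_mem {η : Fin (n + 1) → ℕ} {u v : Fin (n + 1)} (huv : u < v)
    (h : η v < η u) : X v * divDiff u v (mono η) ∈ lower K η := by
  rw [X_right_mul_divDiff_mono huv.ne h]
  refine Submodule.sum_mem _ fun c hc => mono_mem_lower ?_
  rcases Nat.eq_zero_or_pos c with rfl | h0
  · rw [between_zero]
    exact prec_swap huv h
  · exact prec_between huv.ne h0 (Finset.mem_range.mp hc)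

theorem divDiff_mono_of_eq {η : Fin (n + 1) → ℕ} {i p : Fin (n + 1)} (h : η i = η p) :
    divDiff i p (mono η : MvPolynomial (Fin (n + 1)) K) = 0 := by
  rcases eq_or_ne i p with rfl | hip
  · simp [divDiff_self]
  · apply divDiff_eq_of_mul_eq hip
    rw [permAct_mono, Equiv.swap_inv]
    have : η ∘ Equiv.swap i p = η := by
      funext j
      simp only [Function.comp_apply, Equiv.swap_apply_def]
      split_ifs with h1 h2
      · rw [h1, h]
      · rw [h2, h]
      · rfl
    rw [this, sub_self, mul_zero]

/-- The swapped monomial occurs only when the multiplying variable is the one at the smaller part.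
The index `max i p` selects it only if the larger part stands on the left, and then swapping goes
down in ≺. -/
theorem X_max_mul_divDiff_mono_sub_mem (η : Fin (n + 1) → ℕ) (i p : Fin (n + 1)) :
    X (max i p) * divDiff i p (mono η) -
      ((if p < i ∧ η p < η i then 1 else 0) - (if i < p ∧ η i < η p then 1 else 0) : K) • mono η
      ∈ lower K η := by
  rcases lt_trichotomy (η i) (η p) with h | h | h
  · have hne : p ≠ i := by rintro rfl; exact h.ne rfl
    rw [if_neg (by omega), divDiff_comm]
    rcases lt_or_gt_of_ne hne with h1 | h1
    · rw [if_neg (by omega), max_eq_left h1.le, sub_zero, zero_smul, sub_zero, mul_neg]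
      exact Submodule.neg_mem _ (X_right_mul_divDiff_mono_mem h1 h)
    · rw [if_pos ⟨h1, h⟩, max_eq_right h1.le, zero_sub, neg_smul, one_smul, mul_neg, ← neg_sub']
      exact Submodule.neg_mem _ (X_left_mul_divDiff_mono_sub_mem hne h)
  · rw [if_neg (by omega), if_neg (by omega), divDiff_mono_of_eq h]
    simp
  · have hne : i ≠ p := by rintro rfl; exact h.ne rfl
    rw [if_neg (c := i < p ∧ η i < η p) (by omega)]
    rcases lt_or_gt_of_ne hne with h1 | h1
    · rw [if_neg (by omega), max_eq_right h1.le, sub_zero, zero_smul, sub_zero]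
      exact X_right_mul_divDiff_mono_mem h1 h
    · rw [if_pos ⟨h1, h⟩, max_eq_left h1.le, sub_zero, one_smul]
      exact X_left_mul_divDiff_mono_sub_mem hne h

theorem etaBar_eq_sum (α : K) (η : Fin (n + 1) → ℕ) (i : Fin (n + 1)) :
    etaBar α η i = α * η i + ∑ p, ((if p < i ∧ η p < η i then 1 else 0) -
      (if i < p ∧ η i < η p then 1 else 0) : K) - (i : ℕ) := by
  have h1 : ((Finset.Iio i).filter fun k => η i ≤ η k).card +
      (Finset.univ.filter fun p => p < i ∧ η p < η i).card = i := by
    have e : (Finset.univ.filter fun p => p < i ∧ η p < η i) =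
        (Finset.Iio i).filter fun k => ¬ η i ≤ η k := by
      ext p; simp
    rw [e, Finset.card_filter_add_card_filter_not, Fin.card_Iio]
  have h2 : ((Finset.Ioi i).filter fun k => η i < η k) =
      Finset.univ.filter fun p => i < p ∧ η i < η p := by
    ext p; simp
  have h3 : (((Finset.Iio i).filter fun k => η i ≤ η k).card : K) +
      ((Finset.univ.filter fun p => p < i ∧ η p < η i).card : K) = (i : ℕ) := by
    rw [← Nat.cast_add, h1]
  rw [etaBar, h2, Finset.sum_sub_distrib, Finset.sum_boole, Finset.sum_boole]
  linear_combination -h3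

/-- The operators `ξ_i` are triangular. -/
theorem xi_mono_sub_mem (α : K) (η : Fin (n + 1) → ℕ) (i : Fin (n + 1)) :
    xi α i (mono η) - etaBar α η i • mono η ∈ lower K η := by
  have h := Submodule.sum_mem _ fun p (_ : p ∈ Finset.univ) =>
    X_max_mul_divDiff_mono_sub_mem (K := K) η i p
  rw [Finset.sum_sub_distrib, ← Finset.sum_smul] at h
  have hd : (X i * pderiv i (mono η) : MvPolynomial (Fin (n + 1)) K) = (η i : K) • mono η := by
    rw [mono, X_mul_pderiv_monomial, Nat.cast_smul_eq_nsmul]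
    rfl
  rw [xi_apply, hd, etaBar_eq_sum]
  convert h using 1
  simp only [sub_smul, add_smul, smul_smul]
  abel

/-- No monomial of f lies above z^ν, so by triangularity only the diagonal entry contributes. -/
theorem coef_xi_of_maximal (α : K) {f : MvPolynomial (Fin (n + 1)) K} {ν : Fin (n + 1) → ℕ}
    (hν : ∀ μ, coef μ f ≠ 0 → ¬ Prec ν μ) (i : Fin (n + 1)) :
    coef ν (xi α i f) = etaBar α ν i * coef ν f := by
  have h : ∀ μ, coef ν (coef μ f • xi α i (mono μ)) =
      coef ν (coef μ f • etaBar α ν i • (mono μ : MvPolynomial (Fin (n + 1)) K)) := by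
    intro μ
    by_cases h0 : coef μ f = 0
    · simp [h0]
    have h1 := xi_mono_sub_mem α μ i ν (hν μ h0)
    rw [map_sub, sub_eq_zero] at h1
    rw [map_smul, map_smul, h1, map_smul, map_smul, coef_mono]
    split_ifs with h2
    · rw [h2]
    · simp
  conv_lhs => rw [eq_sum_coef_smul_mono f]
  conv_rhs => rw [eq_sum_coef_smul_mono f]
  rw [map_sum, map_sum, ← smul_eq_mul, ← map_smul, Finset.smul_sum, map_sum]
  apply Finset.sum_congr rfl
  intro d _
  rw [map_smul (xi α i), h, smul_comm]

theorem exists_maximal_coef_ne_zero {f : MvPolynomial (Fin (n + 1)) K} {ν : Fin (n + 1) → ℕ}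
    (hν : coef ν f ≠ 0) : ∃ μ, (ν = μ ∨ Prec ν μ) ∧ coef μ f ≠ 0 ∧
      ∀ κ, coef κ f ≠ 0 → ¬ Prec μ κ := by
  classical
  have hmem : ∀ κ, κ ∈ f.support.image (fun d : Fin (n + 1) →₀ ℕ => ⇑d) ↔ coef κ f ≠ 0 := by
    intro κ
    simp only [Finset.mem_image, mem_support_iff, coef_apply]
    constructor
    · rintro ⟨d, hd, rfl⟩
      rwa [Finsupp.equivFunOnFinite_symm_coe]
    · exact fun h => ⟨_, h, rfl⟩
  obtain ⟨μ, hμ, hmax⟩ := exists_prec_maximal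
    (s := (f.support.image (fun d : Fin (n + 1) →₀ ℕ => ⇑d)).filter fun μ => ν = μ ∨ Prec ν μ)
    ⟨ν, Finset.mem_filter.mpr ⟨(hmem ν).mpr hν, Or.inl rfl⟩⟩
  rw [Finset.mem_filter, hmem] at hμ
  refine ⟨μ, hμ.2, hμ.1, fun κ hκ h => hmax κ ?_ h⟩
  rw [Finset.mem_filter, hmem]
  refine ⟨hκ, Or.inr ?_⟩
  rcases hμ.2 with rfl | h'
  · exact h
  · exact h'.trans h

end Triangular

/-! ### Nonsymmetric Jack polynomials: existence, uniqueness, action of s_i. -/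

section Jack

variable {K : Type*} [Field K] [CharZero K] {n : ℕ} {α : K}

omit [CharZero K] in
theorem etaBar_eq_of_maximal {f : MvPolynomial (Fin (n + 1)) K} {c : Fin (n + 1) → K}
    (hf : ∀ i, xi α i f = c i • f) {ν : Fin (n + 1) → ℕ} (h0 : coef ν f ≠ 0)
    (hν : ∀ μ, coef μ f ≠ 0 → ¬ Prec ν μ) (i : Fin (n + 1)) : etaBar α ν i = c i := by
  have h := coef_xi_of_maximal α hν i
  rw [hf, map_smul, smul_eq_mul] at h
  exact (mul_right_cancel₀ h0 h).symm

/-- Any maximal exponent has the eigenvalues as its spectral vector, hence is η. So every nonzero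
joint eigenvector is triangular, and existence of E_η needs only some nonzero eigenvector. -/
theorem eq_or_prec_of_joint_eigenvector (hα : ∀ q : ℚ, q ≤ 0 → α ≠ (q : K))
    {f : MvPolynomial (Fin (n + 1)) K} {η : Fin (n + 1) → ℕ}
    (hf : ∀ i, xi α i f = etaBar α η i • f) {ν : Fin (n + 1) → ℕ} (h0 : coef ν f ≠ 0) :
    (ν = η ∨ Prec ν η) ∧ coef η f ≠ 0 := by
  obtain ⟨μ, hμ, h1, hmax⟩ := exists_maximal_coef_ne_zero h0
  have : μ = η := eq_comp_of_etaBar_eq hα 1 (etaBar_eq_of_maximal hf h1 hmax)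
  subst this
  exact ⟨hμ, h1⟩

theorem eq_smul_of_joint_eigenvector (hα : ∀ q : ℚ, q ≤ 0 → α ≠ (q : K))
    {f E : MvPolynomial (Fin (n + 1)) K} {η : Fin (n + 1) → ℕ}
    (hf : ∀ i, xi α i f = etaBar α η i • f) (hE : IsNonsymJack α η E) : f = coef η f • E := by
  by_contra hne
  obtain ⟨ν, hν⟩ := exists_coef_ne_zero (sub_ne_zero.mpr hne)
  have := (eq_or_prec_of_joint_eigenvector hα (η := η) (fun i => by
    rw [map_sub, map_smul, hf, hE.1, smul_sub, smul_comm]) hν).2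
  apply this
  have h1 : coef η E = 1 := hE.2.1
  rw [map_sub, map_smul, h1, smul_eq_mul, mul_one, sub_self]

theorem exists_isNonsymJack (hα : ∀ q : ℚ, q ≤ 0 → α ≠ (q : K))
    {f : MvPolynomial (Fin (n + 1)) K} {η : Fin (n + 1) → ℕ} (h0 : f ≠ 0)
    (hf : ∀ i, xi α i f = etaBar α η i • f) : ∃ E, IsNonsymJack α η E := by
  obtain ⟨ν, hν⟩ := exists_coef_ne_zero h0
  have h1 := (eq_or_prec_of_joint_eigenvector hα hf hν).2
  refine ⟨(coef η f)⁻¹ • f, fun i => by rw [map_smul, hf, smul_comm], ?_, fun μ hμ => ?_⟩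
  · rw [← coef_apply, map_smul, smul_eq_mul, inv_mul_cancel₀ h1]
  · rw [← coef_apply, map_smul, smul_eq_mul] at hμ
    exact (eq_or_prec_of_joint_eigenvector hα hf (right_ne_zero_of_mul hμ)).1

/-- The intertwiner attached to `s_i`. -/
noncomputable def intertwiner (α : K) (ν : Fin (n + 1) → ℕ) (i : Fin n)
    (f : MvPolynomial (Fin (n + 1)) K) : MvPolynomial (Fin (n + 1)) K :=
  permAct (simpleRefl i) f - (etaBar α ν i.castSucc - etaBar α ν i.succ)⁻¹ • f

omit [CharZero K] in
theorem xi_intertwiner {ν : Fin (n + 1) → ℕ} {i : Fin n}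
    (hne : etaBar α ν i.castSucc - etaBar α ν i.succ ≠ 0) {f : MvPolynomial (Fin (n + 1)) K}
    (hf : ∀ j, xi α j f = etaBar α ν j • f) (j : Fin (n + 1)) :
    xi α j (intertwiner α ν i f) = etaBar α ν (simpleRefl i j) • intertwiner α ν i f := by
  set p := (etaBar α ν i.castSucc - etaBar α ν i.succ)⁻¹ with hp
  have hp1 : p * (etaBar α ν i.castSucc - etaBar α ν i.succ) = 1 := inv_mul_cancel₀ hne
  have hC : (C p : MvPolynomial (Fin (n + 1)) K) *
      (C (etaBar α ν i.castSucc) - C (etaBar α ν i.succ)) = 1 := by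
    rw [← map_sub, ← map_mul, hp1, map_one]
  rw [intertwiner, map_sub, map_smul, hf]
  by_cases h1 : j = i.castSucc
  · subst h1
    have h := permAct_simpleRefl_xi_succ α i f
    rw [hf, map_smul] at h
    rw [simpleRefl_castSucc, ← hp, eq_sub_iff_add_eq.mp h |>.symm]
    simp only [smul_eq_C_mul]
    linear_combination -f * hC
  by_cases h2 : j = i.succ
  · subst h2
    have h := permAct_simpleRefl_xi_castSucc α i f
    rw [hf, map_smul] at h
    rw [simpleRefl_succ, ← hp, eq_sub_iff_add_eq.mpr h.symm]
    simp only [smul_eq_C_mul]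
    linear_combination f * hC
  · rw [← permAct_simpleRefl_xi_of_ne α i h1 h2, hf, map_smul, simpleRefl_of_ne h1 h2, smul_sub,
      smul_comm p]

/-- If it vanished, s_i f = d⁻¹ f, and s_i² = 1 would force d = ±1. -/
theorem intertwiner_ne_zero (hα : ∀ q : ℚ, q ≤ 0 → α ≠ (q : K)) {ν : Fin (n + 1) → ℕ} {i : Fin n}
    (hν : ν i.castSucc ≠ ν i.succ) {f : MvPolynomial (Fin (n + 1)) K} (h0 : f ≠ 0) :
    intertwiner α ν i f ≠ 0 := by
  intro h
  obtain ⟨hd0, hd1, hd2⟩ := etaBar_sub_ne' hα hν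
  rw [intertwiner, sub_eq_zero] at h
  have h2 := congrArg (permAct (simpleRefl i)) h
  rw [permAct_simpleRefl_self, map_smul, h, smul_smul] at h2
  have h3 := smul_left_injective K h0 ((one_smul K f).trans h2)
  have h4 : (etaBar α ν i.castSucc - etaBar α ν i.succ) *
      (etaBar α ν i.castSucc - etaBar α ν i.succ) = 1 := by
    field_simp at h3
    linear_combination h3
  rcases mul_self_eq_one_iff.mp h4 with h5 | h5
  · exact hd1 h5
  · exact hd2 h5

theorem raise_surjective_of_pos {η : Fin (n + 1) → ℕ} (h : 0 < η (Fin.last n)) :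
    ∃ μ, raise μ = η ∧ ∑ j, μ j < ∑ j, η j := by
  set μ : Fin (n + 1) → ℕ := fun j =>
    η ((finRotate (n + 1)).symm j) - if j = 0 then 1 else 0 with hμ
  have hr : raise μ = η := by
    funext j
    simp only [raise, hμ, Equiv.symm_apply_apply]
    by_cases hj : j = Fin.last n
    · subst hj
      simp only [finRotate_last, if_true]
      omega
    · have : finRotate (n + 1) j ≠ 0 := fun e =>
        hj ((finRotate (n + 1)).injective (e.trans finRotate_last.symm))
      rw [if_neg this, if_neg hj, Nat.sub_zero, Nat.add_zero]
  refine ⟨μ, hr, ?_⟩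
  have : ∑ j, raise μ j = ∑ j, μ j + 1 := by
    simp only [raise]
    rw [Finset.sum_add_distrib, Equiv.sum_comp (finRotate (n + 1)) μ]
    simp
  rw [hr] at this
  omega

theorem exists_joint_eigenvector (hα : ∀ q : ℚ, q ≤ 0 → α ≠ (q : K)) (d : ℕ) :
    ∀ η : Fin (n + 1) → ℕ, ∑ j, η j = d → ∃ f : MvPolynomial (Fin (n + 1)) K, f ≠ 0 ∧
      ∀ i, xi α i f = etaBar α η i • f := by
  induction d using Nat.strong_induction_on with
  | _ d ihd =>
    -- Within one degree, descend on a position j of a positive part: intertwiners carry that part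
    -- to the last place, where the raising operator reduces the degree. Only η = 0, with the
    -- constant 1, remains.
    suffices H : ∀ j : Fin (n + 1), ∀ η : Fin (n + 1) → ℕ, ∑ j, η j = d → 0 < η j →
        ∃ f : MvPolynomial (Fin (n + 1)) K, f ≠ 0 ∧ ∀ i, xi α i f = etaBar α η i • f by
      intro η hη
      by_cases h : ∃ j, 0 < η j
      · obtain ⟨j, hj⟩ := h
        exact H j η hη hj
      · have h0 : η = 0 := by
          funext j
          simpa using not_exists.mp h j
        subst h0
        refine ⟨1, one_ne_zero, fun i => ?_⟩
        have h1 : ∀ p, divDiff i p (1 : MvPolynomial (Fin (n + 1)) K) = 0 := by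
          intro p
          rcases eq_or_ne i p with rfl | hip
          · simp [divDiff_self]
          · apply divDiff_eq_of_mul_eq hip
            rw [permAct, AlgHom.toLinearMap_apply, map_one, sub_self, mul_zero]
        rw [xi_apply, pderiv_one]
        simp [h1, etaBar]
    intro j
    induction j using Fin.reverseInduction with
    | last =>
      intro η hη hj
      obtain ⟨μ, rfl, hμ⟩ := raise_surjective_of_pos hj
      obtain ⟨f, hf0, hf⟩ := ihd _ (hη ▸ hμ) μ rfl
      refine ⟨raiseOp f, fun e => hf0 (raiseOp_injective (e.trans (map_zero _).symm)),
        fun i => ?_⟩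
      rw [etaBar_raise]
      induction i using Fin.lastCases with
      | last =>
        rw [xi_raiseOp_last, hf, map_smul, finRotate_last, if_pos rfl, add_smul]
      | cast i =>
        rw [xi_raiseOp_castSucc, hf, map_smul, finRotate_castSucc',
          if_neg (Fin.castSucc_ne_last i), add_zero]
    | cast j ih =>
      intro η hη hj
      rcases Nat.eq_zero_or_pos (η j.succ) with h0 | h0
      · have hη' : ∑ i, (η ∘ simpleRefl j) i = d :=
          (Equiv.sum_comp (simpleRefl j) η).trans hη
        obtain ⟨f, hf0, hf⟩ := ih (η ∘ simpleRefl j) hη'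
          (by rwa [Function.comp_apply, simpleRefl_succ])
        have hne : (η ∘ simpleRefl j) j.castSucc ≠ (η ∘ simpleRefl j) j.succ := by
          simp only [Function.comp_apply, simpleRefl_succ, simpleRefl_castSucc]
          omega
        refine ⟨intertwiner α (η ∘ simpleRefl j) j f, intertwiner_ne_zero hα hne hf0,
          fun i => ?_⟩
        rw [xi_intertwiner (etaBar_sub_ne' hα hne).1 hf, ← etaBar_comp_simpleRefl j hne]
        congr 2
        funext k
        simp [simpleRefl_simpleRefl]
      · exact ih η hη h0

theorem nonsymJack_spec (hα : ∀ q : ℚ, q ≤ 0 → α ≠ (q : K)) (η : Fin (n + 1) → ℕ) :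
    IsNonsymJack α η (nonsymJack α η) := by
  obtain ⟨f, h0, hf⟩ := exists_joint_eigenvector hα _ η rfl
  exact Classical.epsilon_spec (exists_isNonsymJack hα h0 hf)

theorem coef_nonsymJack_self (hα : ∀ q : ℚ, q ≤ 0 → α ≠ (q : K)) (η : Fin (n + 1) → ℕ) :
    coef η (nonsymJack α η) = 1 :=
  (nonsymJack_spec hα η).2.1

theorem coef_nonsymJack_eq_zero (hα : ∀ q : ℚ, q ≤ 0 → α ≠ (q : K)) {ν η : Fin (n + 1) → ℕ}
    (h : Prec η ν) : coef ν (nonsymJack α η) = 0 := by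
  by_contra h0
  rcases (nonsymJack_spec hα η).2.2 ν h0 with rfl | h1
  · exact Prec.irrefl h
  · exact h.asymm h1

theorem comp_simpleRefl_of_eq {i : Fin n} {ν : Fin (n + 1) → ℕ} (h : ν i.castSucc = ν i.succ) :
    ν ∘ simpleRefl i = ν := by
  funext j
  simp only [Function.comp_apply, simpleRefl, Equiv.swap_apply_def]
  split_ifs with h1 h2
  · rw [h1, h]
  · rw [h2, h]
  · rfl

theorem comp_simpleRefl_comp_simpleRefl (i : Fin n) (ν : Fin (n + 1) → ℕ) :
    (ν ∘ simpleRefl i) ∘ simpleRefl i = ν := by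
  funext j
  simp [simpleRefl_simpleRefl]

/-- Here d = 1. If s_i E_ν - E_ν were nonzero, it would have the spectral vector of ν with two
distinct entries exchanged, which could only belong to ν ∘ s_i = ν. -/
theorem permAct_nonsymJack_of_eq (hα : ∀ q : ℚ, q ≤ 0 → α ≠ (q : K)) {i : Fin n}
    {ν : Fin (n + 1) → ℕ} (h : ν i.castSucc = ν i.succ) :
    permAct (simpleRefl i) (nonsymJack α ν) = nonsymJack α ν := by
  have hd : etaBar α ν i.castSucc - etaBar α ν i.succ = 1 := etaBar_sub_of_eq i h
  have hx := xi_intertwiner (i := i) (by rw [hd]; exact one_ne_zero) (nonsymJack_spec hα ν).1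
  have h0 : intertwiner α ν i (nonsymJack α ν) = 0 := by
    by_contra hne
    obtain ⟨κ, hκ⟩ := exists_coef_ne_zero hne
    obtain ⟨μ, -, h1, hmax⟩ := exists_maximal_coef_ne_zero hκ
    have h2 := etaBar_eq_of_maximal hx h1 hmax
    have h3 := eq_comp_of_etaBar_eq hα (simpleRefl i) h2
    rw [comp_simpleRefl_of_eq h] at h3
    have h4 := etaBar_injective hα ν ((congrArg (etaBar α · i.castSucc) h3).symm.trans
      (h2 i.castSucc))
    rw [simpleRefl_castSucc] at h4
    simp [Fin.ext_iff] at h4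
  rw [intertwiner, hd, inv_one, one_smul, sub_eq_zero] at h0
  exact h0

/-- The intertwiner sends E_ν to a multiple of the next polynomial; the factor is 1 because E_ν has
no monomial above z^ν. -/
theorem permAct_nonsymJack_of_lt (hα : ∀ q : ℚ, q ≤ 0 → α ≠ (q : K)) {i : Fin n}
    {ν : Fin (n + 1) → ℕ} (h : ν i.castSucc < ν i.succ) :
    permAct (simpleRefl i) (nonsymJack α ν) =
      (etaBar α ν i.castSucc - etaBar α ν i.succ)⁻¹ • nonsymJack α ν +
        nonsymJack α (ν ∘ simpleRefl i) := by
  have hx : ∀ j, xi α j (intertwiner α ν i (nonsymJack α ν)) =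
      etaBar α (ν ∘ simpleRefl i) j • intertwiner α ν i (nonsymJack α ν) := by
    intro j
    rw [etaBar_comp_simpleRefl i h.ne,
      xi_intertwiner (etaBar_sub_ne' hα h.ne).1 (nonsymJack_spec hα ν).1]
  have hlt : Prec ν (ν ∘ simpleRefl i) := by
    have := prec_swap (η := ν ∘ simpleRefl i) (u := i.castSucc) (v := i.succ)
      (by simp [Fin.lt_def])
      (by simpa only [Function.comp_apply, simpleRefl_castSucc, simpleRefl_succ] using h)
    rwa [show Equiv.swap i.castSucc i.succ = simpleRefl i from rfl,
      comp_simpleRefl_comp_simpleRefl] at this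
  have h1 := eq_smul_of_joint_eigenvector hα hx (nonsymJack_spec hα _)
  rw [intertwiner, map_sub, map_smul, coef_permAct, comp_simpleRefl_comp_simpleRefl,
    coef_nonsymJack_self hα, coef_nonsymJack_eq_zero hα hlt, smul_zero, sub_zero, one_smul,
    sub_eq_iff_eq_add'] at h1
  exact h1

theorem permAct_nonsymJack_of_gt (hα : ∀ q : ℚ, q ≤ 0 → α ≠ (q : K)) {i : Fin n}
    {ν : Fin (n + 1) → ℕ} (h : ν i.succ < ν i.castSucc) :
    permAct (simpleRefl i) (nonsymJack α ν) =
      (etaBar α ν i.castSucc - etaBar α ν i.succ)⁻¹ • nonsymJack α ν +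
        (1 - (etaBar α ν i.castSucc - etaBar α ν i.succ)⁻¹ ^ 2) •
          nonsymJack α (ν ∘ simpleRefl i) := by
  have h1 := permAct_nonsymJack_of_lt hα (i := i) (ν := ν ∘ simpleRefl i)
    (by simpa only [Function.comp_apply, simpleRefl_castSucc, simpleRefl_succ] using h)
  rw [comp_simpleRefl_comp_simpleRefl, etaBar_comp_simpleRefl i h.ne', simpleRefl_castSucc,
    etaBar_comp_simpleRefl i h.ne', simpleRefl_succ, ← neg_sub, inv_neg] at h1
  set p := (etaBar α ν i.castSucc - etaBar α ν i.succ)⁻¹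
  have h2 := congrArg (permAct (simpleRefl i)) h1
  rw [permAct_simpleRefl_self, map_add, map_smul, h1] at h2
  simp only [smul_eq_C_mul, map_sub, map_neg, map_one, map_pow] at h2 ⊢
  linear_combination -h2

end Jack

end PrescribedJack

namespace PrescribedJack

/-! ### Blocks, positive roots and orbits of the parabolic subgroup. -/

section Orbits

variable {n : ℕ}

theorem simpleRefl_mem_parabolic {A : Finset (Fin n)} {i : Fin n} (hi : i ∈ A) :
    simpleRefl i ∈ parabolic A :=
  Subgroup.subset_closure ⟨i, hi, rfl⟩

@[elab_as_elim]
theorem parabolic_induction {A : Finset (Fin n)}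
    {P : (w : Equiv.Perm (Fin (n + 1))) → w ∈ parabolic A → Prop} (one : P 1 (one_mem _))
    (mul : ∀ w (hw : w ∈ parabolic A), ∀ i (hi : i ∈ A), P w hw →
      P (w * simpleRefl i) (mul_mem hw (simpleRefl_mem_parabolic hi)))
    {w : Equiv.Perm (Fin (n + 1))} (hw : w ∈ parabolic A) : P w hw := by
  induction hw using Subgroup.closure_induction_right with
  | one => exact one
  | mul_right x hx y hy h =>
    obtain ⟨i, hi, rfl⟩ := hy
    exact mul x hx i hi h
  | mul_inv_cancel x hx y hy h =>
    obtain ⟨i, hi, rfl⟩ := hy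
    simpa only [simpleRefl_inv] using mul x hx i hi h

/-- The positions `x` and `y` lie in the same block with respect to `A`. -/
def SameBlock (A : Finset (Fin n)) (x y : Fin (n + 1)) : Prop :=
  ∀ i : Fin n, min (x : ℕ) y ≤ i → (i : ℕ) < max (x : ℕ) y → i ∈ A

theorem SameBlock.symm {A : Finset (Fin n)} {x y : Fin (n + 1)} (h : SameBlock A x y) :
    SameBlock A y x := fun i h1 h2 => h i (by omega) (by omega)

theorem SameBlock.trans {A : Finset (Fin n)} {x y z : Fin (n + 1)} (h : SameBlock A x y)
    (h' : SameBlock A y z) : SameBlock A x z := by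
  intro i h1 h2
  by_cases h3 : min (x : ℕ) y ≤ i ∧ (i : ℕ) < max (x : ℕ) y
  · exact h i h3.1 h3.2
  · exact h' i (by omega) (by omega)

theorem sameBlock_simpleRefl {A : Finset (Fin n)} {i : Fin n} (hi : i ∈ A) (x : Fin (n + 1)) :
    SameBlock A (simpleRefl i x) x := by
  intro j h1 h2
  simp only [simpleRefl, Equiv.swap_apply_def] at h1 h2
  have : j = i := by
    split_ifs at h1 h2 with h3 h4
    · subst h3
      simp only [Fin.val_succ, Fin.val_castSucc] at h1 h2
      exact Fin.ext (by omega)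
    · subst h4
      simp only [Fin.val_succ, Fin.val_castSucc] at h1 h2
      exact Fin.ext (by omega)
    · omega
  exact this ▸ hi

theorem sameBlock_of_mem_parabolic {A : Finset (Fin n)} {w : Equiv.Perm (Fin (n + 1))}
    (hw : w ∈ parabolic A) : ∀ x, SameBlock A (w x) x := by
  induction hw using parabolic_induction with
  | one => exact fun x i h1 h2 => by simp only [Equiv.Perm.one_apply] at h1 h2; omega
  | mul w hw i hi h => exact fun x => (h _).trans (sameBlock_simpleRefl hi x)

theorem mem_posRoots {A : Finset (Fin n)} {b : Fin (n + 1) × Fin (n + 1)} :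
    b ∈ posRoots A ↔ b.1 < b.2 ∧ SameBlock A b.1 b.2 := by
  simp only [posRoots, Finset.mem_filter, Finset.mem_univ, true_and]
  refine and_congr_right fun h => forall_congr' fun i => ?_
  simp only [Fin.le_def, Fin.lt_def, Fin.val_castSucc] at *
  rw [min_eq_left h.le, max_eq_right h.le]

/-- The pair of positions which is coded by the simple root of `s_i`. -/
def simplePair (i : Fin n) : Fin (n + 1) × Fin (n + 1) := (i.castSucc, i.succ)

/-- The action of `s_i` on pairs of positions. -/
def reflPair (i : Fin n) (b : Fin (n + 1) × Fin (n + 1)) : Fin (n + 1) × Fin (n + 1) :=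
  (simpleRefl i b.1, simpleRefl i b.2)

theorem reflPair_reflPair (i : Fin n) (b : Fin (n + 1) × Fin (n + 1)) :
    reflPair i (reflPair i b) = b := by
  simp [reflPair, simpleRefl_simpleRefl]

theorem simplePair_mem_posRoots {A : Finset (Fin n)} {i : Fin n} :
    simplePair i ∈ posRoots A ↔ i ∈ A := by
  rw [mem_posRoots]
  constructor
  · intro h
    exact h.2 i (by simp [simplePair]) (by simp [simplePair])
  · intro h
    refine ⟨by simp [simplePair, Fin.lt_def], ?_⟩
    have := (sameBlock_simpleRefl h i.castSucc).symm
    rwa [simpleRefl_castSucc] at this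

theorem reflPair_mem_posRoots {A : Finset (Fin n)} {i : Fin n} (hi : i ∈ A)
    {b : Fin (n + 1) × Fin (n + 1)} (hb : b ∈ posRoots A) (hne : b ≠ simplePair i) :
    reflPair i b ∈ posRoots A := by
  rw [mem_posRoots] at hb ⊢
  refine ⟨(simpleRefl_lt_iff ?_ ?_).mpr hb.1,
    ((sameBlock_simpleRefl hi _).trans hb.2).trans (sameBlock_simpleRefl hi _).symm⟩
  · exact fun h => hne (Prod.ext h.1 h.2)
  · intro h
    have := hb.1
    rw [h.1, h.2] at this
    simp [Fin.lt_def] at this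

theorem reflPair_ne_simplePair {A : Finset (Fin n)} {i : Fin n}
    {b : Fin (n + 1) × Fin (n + 1)} (hb : b ∈ posRoots A) : reflPair i b ≠ simplePair i := by
  intro h
  have h1 := congrArg (reflPair i) h
  rw [reflPair_reflPair] at h1
  have := (mem_posRoots.mp hb).1
  rw [h1] at this
  simp [reflPair, simplePair, simpleRefl_castSucc, simpleRefl_succ, Fin.lt_def] at this

theorem reflPair_of_separated {J : Finset (Fin n)} {i : Fin n} (hi : i ∉ J)
    (hsep : ∀ j ∈ J, (i : ℕ) + 1 ≠ j ∧ (j : ℕ) + 1 ≠ i)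
    {b : Fin (n + 1) × Fin (n + 1)} (hb : b ∈ posRoots J) : reflPair i b = b := by
  obtain ⟨hlt, hB⟩ := mem_posRoots.mp hb
  rw [Fin.lt_def] at hlt
  have h1 := b.1.2
  have h2 := b.2.2
  have hm1 : (⟨b.1, by omega⟩ : Fin n) ∈ J := hB _ (by simp) (by simpa using hlt)
  have hm2 : (⟨b.2 - 1, by omega⟩ : Fin n) ∈ J :=
    hB _ (by simp only; omega) (by simp only; omega)
  have hs1 := hsep _ hm1
  have hs2 := hsep _ hm2
  have hn1 : (b.1 : ℕ) ≠ i := fun h => hi ((Fin.ext h.symm : i = ⟨b.1, by omega⟩) ▸ hm1)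
  have hn2 : (b.2 : ℕ) - 1 ≠ i := fun h => hi ((Fin.ext h.symm : i = ⟨b.2 - 1, by omega⟩) ▸ hm2)
  simp only at hs1 hs2
  apply Prod.ext
  · apply simpleRefl_of_ne <;>
      simp only [ne_eq, Fin.ext_iff, Fin.val_castSucc, Fin.val_succ] <;> omega
  · apply simpleRefl_of_ne <;>
      simp only [ne_eq, Fin.ext_iff, Fin.val_castSucc, Fin.val_succ] <;> omega

/-- A generator from I fixes every root of J because I and J are not adjacent; a generator from J
permutes the positive roots of J other than its own. Hence root signs are invariant. -/
theorem reflPair_mem_posRoots_iff {I J : Finset (Fin n)} (hdisj : Disjoint I J)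
    (hsep : ∀ i ∈ I, ∀ j ∈ J, (i : ℕ) + 1 ≠ j ∧ (j : ℕ) + 1 ≠ i) {i : Fin n} (hi : i ∈ I ∪ J)
    {b : Fin (n + 1) × Fin (n + 1)} (hb : b ∈ posRoots (I ∪ J)) (hne : b ≠ simplePair i) :
    reflPair i b ∈ posRoots J ↔ b ∈ posRoots J := by
  rcases Finset.mem_union.mp hi with h | h
  · have hiJ : i ∉ J := Finset.disjoint_left.mp hdisj h
    constructor
    · intro h1
      have h2 := reflPair_of_separated hiJ (hsep i h) h1
      rw [reflPair_reflPair] at h2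
      rwa [h2]
    · intro h1
      rwa [reflPair_of_separated hiJ (hsep i h) h1]
  · constructor
    · intro h1
      have := reflPair_mem_posRoots h h1 (reflPair_ne_simplePair hb)
      rwa [reflPair_reflPair] at this
    · exact fun h1 => reflPair_mem_posRoots h h1 hne

theorem prod_erase_reflPair {M : Type*} [CommMonoid M] {A : Finset (Fin n)} {i : Fin n}
    (hi : i ∈ A) (g : Fin (n + 1) × Fin (n + 1) → M) :
    ∏ b ∈ (posRoots A).erase (simplePair i), g (reflPair i b) =
      ∏ b ∈ (posRoots A).erase (simplePair i), g b := by
  have hmap : ∀ b ∈ (posRoots A).erase (simplePair i),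
      reflPair i b ∈ (posRoots A).erase (simplePair i) := by
    intro b hb
    rw [Finset.mem_erase] at hb ⊢
    exact ⟨reflPair_ne_simplePair hb.2, reflPair_mem_posRoots hi hb.2 hb.1⟩
  exact Finset.prod_nbij' (reflPair i) (reflPair i) hmap hmap
    (fun b _ => reflPair_reflPair i b) (fun b _ => reflPair_reflPair i b) (fun b _ => rfl)

open Classical in
/-- The orbit of `η` under the group generated by the `s_i` with `i ∈ A`. -/
noncomputable def orbit (A : Finset (Fin n)) (η : Fin (n + 1) → ℕ) :
    Finset (Fin (n + 1) → ℕ) :=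
  (Finset.univ.filter fun w : Equiv.Perm (Fin (n + 1)) => w ∈ parabolic A).image fun w => η ∘ w

theorem mem_orbit {A : Finset (Fin n)} {η ν : Fin (n + 1) → ℕ} :
    ν ∈ orbit A η ↔ ∃ w ∈ parabolic A, η ∘ ⇑w = ν := by
  simp [orbit]

theorem self_mem_orbit (A : Finset (Fin n)) (η : Fin (n + 1) → ℕ) : η ∈ orbit A η :=
  mem_orbit.mpr ⟨1, one_mem _, rfl⟩

theorem comp_simpleRefl_mem_orbit {A : Finset (Fin n)} {η ν : Fin (n + 1) → ℕ}
    (h : ν ∈ orbit A η) {i : Fin n} (hi : i ∈ A) : ν ∘ simpleRefl i ∈ orbit A η := by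
  obtain ⟨w, hw, rfl⟩ := mem_orbit.mp h
  exact mem_orbit.mpr ⟨w * simpleRefl i, mul_mem hw (simpleRefl_mem_parabolic hi), rfl⟩

theorem orbit_induction {A : Finset (Fin n)} {η : Fin (n + 1) → ℕ}
    {P : (Fin (n + 1) → ℕ) → Prop} (base : P η)
    (step : ∀ ν ∈ orbit A η, ∀ i ∈ A, P ν → P (ν ∘ simpleRefl i)) :
    ∀ ν ∈ orbit A η, P ν := by
  intro ν hν
  obtain ⟨w, hw, rfl⟩ := mem_orbit.mp hν
  clear hν
  induction hw using parabolic_induction with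
  | one => exact base
  | mul w hw i hi h => exact step _ (mem_orbit.mpr ⟨w, hw, rfl⟩) i hi h

theorem le_of_sameBlock {A : Finset (Fin n)} {η : Fin (n + 1) → ℕ}
    (hη : ∀ i ∈ A, η i.succ ≤ η i.castSucc) {x y : Fin (n + 1)} (hxy : x ≤ y)
    (h : SameBlock A x y) : η y ≤ η x := by
  induction y using Fin.induction with
  | zero => rw [Fin.le_zero_iff.mp hxy]
  | succ y ih =>
    rcases hxy.lt_or_eq with hlt | rfl
    · rw [Fin.lt_def, Fin.val_succ] at hlt
      have hy : y ∈ A := h y (by simp only [Fin.val_succ]; omega)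
        (by simp only [Fin.val_succ]; omega)
      refine (hη y hy).trans (ih (by simp only [Fin.le_def, Fin.val_castSucc]; omega) ?_)
      intro i h1 h2
      simp only [Fin.val_castSucc] at h1 h2
      exact h i (by simp only [Fin.val_succ]; omega) (by simp only [Fin.val_succ]; omega)
    · exact le_rfl

theorem lt_of_mem_posRoots {J : Finset (Fin n)} {η : Fin (n + 1) → ℕ}
    (hη : ∀ j ∈ J, η j.succ < η j.castSucc) {b : Fin (n + 1) × Fin (n + 1)}
    (hb : b ∈ posRoots J) : η b.2 < η b.1 := by
  obtain ⟨hlt, hB⟩ := mem_posRoots.mp hb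
  rw [Fin.lt_def] at hlt
  have h2 := b.2.2
  set i : Fin n := ⟨b.1, by omega⟩ with hi
  have hi1 : b.1 = i.castSucc := rfl
  have hiJ : i ∈ J := hB i (by simp [hi]) (by simpa [hi] using hlt)
  refine lt_of_le_of_lt (b := η i.succ) ?_ (hi1 ▸ hη i hiJ)
  refine le_of_sameBlock (fun j hj => (hη j hj).le) ?_ fun k h3 h4 => hB k ?_ ?_ <;>
    simp only [Fin.le_def, Fin.val_succ, hi] at * <;> omega

theorem orbit_prec {A : Finset (Fin n)} {η : Fin (n + 1) → ℕ}
    (hη : ∀ i ∈ A, η i.succ ≤ η i.castSucc) {ν : Fin (n + 1) → ℕ} (hν : ν ∈ orbit A η) :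
    ν = η ∨ Prec ν η := by
  obtain ⟨w, hw, rfl⟩ := mem_orbit.mp hν
  by_cases hne : η ∘ w = η
  · exact Or.inl hne
  have hB := sameBlock_of_mem_parabolic hw
  refine Or.inr (prec_comp_perm w (fun x p h1 h2 => ?_) (fun x p h1 h2 => ?_) hne)
  · refine le_of_sameBlock hη h2.le fun i h3 h4 => hB x i ?_ ?_ <;>
      simp only [Fin.le_def, Fin.lt_def] at h1 h2 <;> omega
  · refine le_of_sameBlock hη h2 fun i h3 h4 => hB x i ?_ ?_ <;>
      simp only [Fin.le_def, Fin.lt_def] at h1 h2 <;> omega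

/-- Equal parts at j, j + 1 with j ∈ J would make E_ν symmetric under s_j, against the required
antisymmetry; the strict inequalities on J rule this out on the whole orbit. -/
theorem orbit_ne {I J : Finset (Fin n)} (hdisj : Disjoint I J)
    (hsep : ∀ i ∈ I, ∀ j ∈ J, (i : ℕ) + 1 ≠ j ∧ (j : ℕ) + 1 ≠ i) {η : Fin (n + 1) → ℕ}
    (hηJ : ∀ j ∈ J, η j.succ < η j.castSucc) :
    ∀ ν ∈ orbit (I ∪ J) η, ∀ b ∈ posRoots J, ν b.1 ≠ ν b.2 := by
  apply orbit_induction
  · exact fun b hb => (lt_of_mem_posRoots hηJ hb).ne'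
  · intro ν _ i hi h b hb
    by_cases hbi : b = simplePair i
    · have := h b hb
      subst hbi
      simp only [simplePair, Function.comp_apply, simpleRefl_castSucc, simpleRefl_succ] at this ⊢
      exact this.symm
    · have hb' : b ∈ posRoots (I ∪ J) := by
        rw [mem_posRoots] at hb ⊢
        exact ⟨hb.1, fun i h1 h2 => Finset.mem_union_right _ (hb.2 i h1 h2)⟩
      exact h _ ((reflPair_mem_posRoots_iff hdisj hsep hi hb' hbi).mpr hb)

end Orbits

/-! ### Expansion coefficients and eigenvalues of O_J. -/

section Coefficients

variable {K : Type*} [Field K] {n : ℕ}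

/-- The sign `ε_i` with which `s_i` acts. -/
def epsSign (K : Type*) [Field K] (J : Finset (Fin n)) (i : Fin n) : K :=
  if i ∈ J then -1 else 1

theorem epsSign_mul_self (J : Finset (Fin n)) (i : Fin n) :
    epsSign K J i * epsSign K J i = 1 := by
  unfold epsSign; split_ifs <;> ring

/-- The sign attached to a positive root. -/
noncomputable def rootSign (K : Type*) [Field K] (J : Finset (Fin n))
    (b : Fin (n + 1) × Fin (n + 1)) : K :=
  if b ∈ posRoots J then -1 else 1

/-- The coefficients of the expansion of the Jack polynomial with prescribed symmetry in terms of
nonsymmetric Jack polynomials. -/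
noncomputable def expCoeff (α : K) (A J : Finset (Fin n)) (ν : Fin (n + 1) → ℕ) : K :=
  ∏ b ∈ posRoots A, if ν b.1 < ν b.2
    then rootSign K J b + (etaBar α ν b.1 - etaBar α ν b.2)⁻¹ else 1

theorem expCoeff_eq_one {α : K} {A J : Finset (Fin n)} {η : Fin (n + 1) → ℕ}
    (hη : ∀ i ∈ A, η i.succ ≤ η i.castSucc) : expCoeff α A J η = 1 := by
  apply Finset.prod_eq_one
  intro b hb
  obtain ⟨h1, h2⟩ := mem_posRoots.mp hb
  rw [if_neg (not_lt.mpr (le_of_sameBlock hη h1.le h2))]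

variable {α : K} {I J : Finset (Fin n)}

/-- The reflection s_i permutes the positive roots other than its own, preserving signs and matching
factors, so the two products differ only in the factor of the simple root. -/
theorem expCoeff_of_lt (hdisj : Disjoint I J)
    (hsep : ∀ i ∈ I, ∀ j ∈ J, (i : ℕ) + 1 ≠ j ∧ (j : ℕ) + 1 ≠ i) {i : Fin n} (hi : i ∈ I ∪ J)
    {ν : Fin (n + 1) → ℕ} (h : ν i.castSucc < ν i.succ) :
    expCoeff α (I ∪ J) J ν =
      (epsSign K J i + (etaBar α ν i.castSucc - etaBar α ν i.succ)⁻¹) *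
        expCoeff α (I ∪ J) J (ν ∘ simpleRefl i) := by
  have hmem : simplePair i ∈ posRoots (I ∪ J) := simplePair_mem_posRoots.mpr hi
  rw [expCoeff, expCoeff, ← Finset.mul_prod_erase _ _ hmem, ← Finset.mul_prod_erase _ _ hmem,
    ← prod_erase_reflPair hi]
  have h1 : ¬ (ν ∘ simpleRefl i) (simplePair i).1 < (ν ∘ simpleRefl i) (simplePair i).2 := by
    simp only [simplePair, Function.comp_apply, simpleRefl_castSucc, simpleRefl_succ]
    omega
  have h2 : rootSign K J (simplePair i) = epsSign K J i := by
    simp only [rootSign, epsSign, simplePair_mem_posRoots]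
  rw [if_neg h1, one_mul, h2]
  congr 1
  · exact if_pos h
  · apply Finset.prod_congr rfl
    intro b hb
    rw [Finset.mem_erase] at hb
    rw [etaBar_comp_simpleRefl i h.ne, etaBar_comp_simpleRefl i h.ne]
    have h3 : rootSign K J (reflPair i b) = rootSign K J b := by
      simp only [rootSign, reflPair_mem_posRoots_iff hdisj hsep hi hb.2 hb.1]
    rw [h3]
    rfl

theorem constC_of_mem {i : Fin n} (hi : i ∈ J) {ν : Fin (n + 1) → ℕ}
    (h : ν i.castSucc ≠ ν i.succ) :
    constC α J ν * (1 - (etaBar α ν i.castSucc - etaBar α ν i.succ)) =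
      constC α J (ν ∘ simpleRefl i) * (1 + (etaBar α ν i.castSucc - etaBar α ν i.succ)) := by
  have hmem : simplePair i ∈ posRoots J := simplePair_mem_posRoots.mpr hi
  rw [constC, constC, ← Finset.mul_prod_erase _ _ hmem, ← Finset.mul_prod_erase _ _ hmem,
    ← prod_erase_reflPair hi]
  simp only [etaBar_comp_simpleRefl i h, reflPair]
  simp only [simplePair, simpleRefl_castSucc, simpleRefl_succ]
  ring

theorem constC_of_separated {i : Fin n} (hi : i ∉ J)
    (hsep : ∀ j ∈ J, (i : ℕ) + 1 ≠ j ∧ (j : ℕ) + 1 ≠ i) {ν : Fin (n + 1) → ℕ}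
    (h : ν i.castSucc ≠ ν i.succ) : constC α J (ν ∘ simpleRefl i) = constC α J ν := by
  apply Finset.prod_congr rfl
  intro b hb
  have hb' := reflPair_of_separated hi hsep hb
  have h1 : simpleRefl i b.1 = b.1 := congrArg Prod.fst hb'
  have h2 : simpleRefl i b.2 = b.2 := congrArg Prod.snd hb'
  rw [etaBar_comp_simpleRefl i h, etaBar_comp_simpleRefl i h, h1, h2]

variable [CharZero K]

/-- An equivalence is needed because a walk through the orbit moves both up and down. -/
theorem expCoeff_mul_constC_iff (hα : ∀ q : ℚ, q ≤ 0 → α ≠ (q : K)) (hdisj : Disjoint I J)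
    (hsep : ∀ i ∈ I, ∀ j ∈ J, (i : ℕ) + 1 ≠ j ∧ (j : ℕ) + 1 ≠ i) {i : Fin n} (hi : i ∈ I ∪ J)
    {ν : Fin (n + 1) → ℕ} (h : ν i.castSucc < ν i.succ) (c : K) :
    expCoeff α (I ∪ J) J ν * constC α J ν = c * expCoeff α (I ∪ J) ∅ ν ↔
      expCoeff α (I ∪ J) J (ν ∘ simpleRefl i) * constC α J (ν ∘ simpleRefl i) =
        c * expCoeff α (I ∪ J) ∅ (ν ∘ simpleRefl i) := by
  have e1 := expCoeff_of_lt (α := α) hdisj hsep hi h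
  have e2 := expCoeff_of_lt (α := α) (I := I ∪ J) (J := ∅) (Finset.disjoint_empty_right _)
    (fun _ _ j hj => absurd hj (Finset.notMem_empty j)) (by simpa using hi) h
  rw [Finset.union_empty, epsSign, if_neg (Finset.notMem_empty i)] at e2
  obtain ⟨hd0, -, hd1⟩ := etaBar_sub_ne' hα h.ne
  rw [e1, e2]
  set d := etaBar α ν i.castSucc - etaBar α ν i.succ
  have hd2 : 1 + d⁻¹ ≠ 0 := by
    intro e
    apply hd1
    field_simp at e
    linear_combination e
  -- For i ∈ J this is (-1 + 1/d)(1 + d) = (1 + 1/d)(1 - d); for i ∈ I the eigenvalue of O_J does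
  -- not change.
  have key : (epsSign K J i + d⁻¹) * constC α J ν =
      (1 + d⁻¹) * constC α J (ν ∘ simpleRefl i) := by
    by_cases hiJ : i ∈ J
    · rw [epsSign, if_pos hiJ]
      have := constC_of_mem (α := α) hiJ h.ne
      field_simp
      linear_combination this
    · have hiI : i ∈ I := (Finset.mem_union.mp hi).resolve_right hiJ
      rw [epsSign, if_neg hiJ, constC_of_separated hiJ (hsep i hiI) h.ne]
  constructor
  · intro e
    apply mul_left_cancel₀ hd2
    linear_combination e - expCoeff α (I ∪ J) J (ν ∘ simpleRefl i) * key
  · intro e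
    linear_combination (1 + d⁻¹) * e + expCoeff α (I ∪ J) J (ν ∘ simpleRefl i) * key

theorem expCoeff_mul_constC (hα : ∀ q : ℚ, q ≤ 0 → α ≠ (q : K)) (hdisj : Disjoint I J)
    (hsep : ∀ i ∈ I, ∀ j ∈ J, (i : ℕ) + 1 ≠ j ∧ (j : ℕ) + 1 ≠ i) {η : Fin (n + 1) → ℕ}
    (hη : ∀ i ∈ I ∪ J, η i.succ ≤ η i.castSucc) : ∀ ν ∈ orbit (I ∪ J) η,
    expCoeff α (I ∪ J) J ν * constC α J ν = constC α J η * expCoeff α (I ∪ J) ∅ ν := by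
  apply orbit_induction
  · rw [expCoeff_eq_one hη, expCoeff_eq_one hη, one_mul, mul_one]
  · intro ν _ i hi h
    rcases lt_trichotomy (ν i.castSucc) (ν i.succ) with h1 | h1 | h1
    · exact (expCoeff_mul_constC_iff hα hdisj hsep hi h1 _).mp h
    · rwa [comp_simpleRefl_of_eq h1]
    · apply (expCoeff_mul_constC_iff hα hdisj hsep hi (ν := ν ∘ simpleRefl i)
        (by simpa only [Function.comp_apply, simpleRefl_castSucc, simpleRefl_succ] using h1)
        _).mpr
      rwa [comp_simpleRefl_comp_simpleRefl]

end Coefficients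

/-! ### The explicit expansion and its symmetry. -/

section Expansion

variable {K : Type*} [Field K] {n : ℕ}

/-- The expansion of the Jack polynomial with prescribed symmetry in terms of nonsymmetric Jack
polynomials. -/
noncomputable def expansion (α : K) (A J : Finset (Fin n)) (η : Fin (n + 1) → ℕ) :
    MvPolynomial (Fin (n + 1)) K :=
  ∑ ν ∈ orbit A η, expCoeff α A J ν • nonsymJack α ν

variable [CharZero K] {α : K} {I J : Finset (Fin n)}

theorem permAct_expansion (hα : ∀ q : ℚ, q ≤ 0 → α ≠ (q : K)) (hdisj : Disjoint I J)
    (hsep : ∀ i ∈ I, ∀ j ∈ J, (i : ℕ) + 1 ≠ j ∧ (j : ℕ) + 1 ≠ i) {η : Fin (n + 1) → ℕ}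
    (hηJ : ∀ j ∈ J, η j.succ < η j.castSucc) {i : Fin n} (hi : i ∈ I ∪ J) :
    permAct (simpleRefl i) (expansion α (I ∪ J) J η) =
      epsSign K J i • expansion α (I ∪ J) J η := by
  set p : (Fin (n + 1) → ℕ) → K :=
    fun ν => (etaBar α ν i.castSucc - etaBar α ν i.succ)⁻¹ with hp
  set B : (Fin (n + 1) → ℕ) → K := fun ν => if ν i.castSucc < ν i.succ then 1 else
    if ν i.castSucc = ν i.succ then 0 else 1 - p ν ^ 2 with hB
  set s : (Fin (n + 1) → ℕ) → (Fin (n + 1) → ℕ) := fun ν => ν ∘ simpleRefl i with hs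
  have hs1 : ∀ ν, s ν i.castSucc = ν i.succ := fun ν => by
    simp only [hs, Function.comp_apply, simpleRefl_castSucc]
  have hs2 : ∀ ν, s ν i.succ = ν i.castSucc := fun ν => by
    simp only [hs, Function.comp_apply, simpleRefl_succ]
  have hss : ∀ ν, s (s ν) = ν := comp_simpleRefl_comp_simpleRefl i
  have hps : ∀ ν, ν i.castSucc ≠ ν i.succ → p (s ν) = -p ν := by
    intro ν h
    simp only [hp, hs]
    rw [etaBar_comp_simpleRefl i h, etaBar_comp_simpleRefl i h, simpleRefl_castSucc,
      simpleRefl_succ, ← neg_sub, inv_neg]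
  -- The three cases in one formula, so that s_i acts by blocks on the pairs ν, `s ν`; the
  -- coefficient vector must be an eigenvector for ε_i, which is `hc`. For unequal parts this
  -- reduces to ε_i² = 1.
  have hact : ∀ ν, permAct (simpleRefl i) (nonsymJack α ν) =
      p ν • nonsymJack α ν + B ν • nonsymJack α (s ν) := by
    intro ν
    rcases lt_trichotomy (ν i.castSucc) (ν i.succ) with h | h | h
    · rw [permAct_nonsymJack_of_lt hα h, hB]
      simp only [if_pos h, one_smul, hp, hs]
    · rw [permAct_nonsymJack_of_eq hα h, hB, hp]
      simp only [if_neg h.not_lt, if_pos h, zero_smul, etaBar_sub_of_eq i h, inv_one, one_smul,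
        add_zero]
    · rw [permAct_nonsymJack_of_gt hα h, hB]
      simp only [if_neg h.not_gt, if_neg h.ne', hp, hs]
  have hc : ∀ ν ∈ orbit (I ∪ J) η, expCoeff α (I ∪ J) J ν * p ν +
      expCoeff α (I ∪ J) J (s ν) * B (s ν) = epsSign K J i * expCoeff α (I ∪ J) J ν := by
    intro ν hν
    have he := epsSign_mul_self (K := K) J i
    rcases lt_trichotomy (ν i.castSucc) (ν i.succ) with h | h | h
    · have h1 : B (s ν) = 1 - p ν ^ 2 := by
        simp only [hB]
        rw [hs1, hs2, if_neg h.not_gt, if_neg h.ne', hps ν h.ne, neg_sq]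
      rw [h1, show expCoeff α (I ∪ J) J ν = (epsSign K J i + p ν) * expCoeff α (I ∪ J) J (s ν)
        from expCoeff_of_lt hdisj hsep hi h]
      linear_combination -expCoeff α (I ∪ J) J (s ν) * he
    · have hiJ : i ∉ J := fun hiJ =>
        orbit_ne hdisj hsep hηJ ν hν _ (simplePair_mem_posRoots.mpr hiJ) h
      have h1 : B (s ν) = 0 := by
        simp only [hB]
        rw [hs1, hs2, if_neg h.not_gt, if_pos h.symm]
      have h2 : p ν = 1 := by
        simp only [hp]
        rw [etaBar_sub_of_eq i h, inv_one]
      rw [h1, h2, epsSign, if_neg hiJ]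
      ring
    · have h1 : B (s ν) = 1 := by
        simp only [hB]
        rw [hs1, hs2, if_pos h]
      have h2 : expCoeff α (I ∪ J) J (s ν) =
          (epsSign K J i + p (s ν)) * expCoeff α (I ∪ J) J (s (s ν)) :=
        expCoeff_of_lt hdisj hsep hi (by rw [hs1, hs2]; exact h)
      rw [h1, h2, hss, hps ν h.ne']
      ring
  have hre : ∑ ν ∈ orbit (I ∪ J) η, (expCoeff α (I ∪ J) J ν * B ν) • nonsymJack α (s ν) =
      ∑ ν ∈ orbit (I ∪ J) η, (expCoeff α (I ∪ J) J (s ν) * B (s ν)) • nonsymJack α ν :=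
    Finset.sum_nbij' s s (fun ν hν => comp_simpleRefl_mem_orbit hν hi)
      (fun ν hν => comp_simpleRefl_mem_orbit hν hi) (fun ν _ => hss ν) (fun ν _ => hss ν)
      (fun ν _ => by rw [hss])
  rw [expansion, map_sum, Finset.smul_sum]
  simp only [map_smul, hact, smul_add, smul_smul, Finset.sum_add_distrib]
  rw [hre, ← Finset.sum_add_distrib]
  apply Finset.sum_congr rfl
  intro ν hν
  rw [← add_smul, hc ν hν]

theorem isMonicTriangular_expansion (hα : ∀ q : ℚ, q ≤ 0 → α ≠ (q : K)) {A : Finset (Fin n)}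
    {η : Fin (n + 1) → ℕ} (hη : ∀ i ∈ A, η i.succ ≤ η i.castSucc) :
    IsMonicTriangular η (expansion α A J η) := by
  constructor
  · rw [← coef_apply, expansion, map_sum, Finset.sum_eq_single η]
    · rw [map_smul, coef_nonsymJack_self hα, expCoeff_eq_one hη, smul_eq_mul, one_mul]
    · intro ν hν hne
      rw [map_smul, coef_nonsymJack_eq_zero hα ((orbit_prec hη hν).resolve_left hne), smul_zero]
    · exact fun h => absurd (self_mem_orbit A η) h
  · intro μ hμ
    rw [← coef_apply, expansion, map_sum] at hμ
    obtain ⟨ν, hν, h⟩ := Finset.exists_ne_zero_of_sum_ne_zero hμ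
    rw [map_smul] at h
    rcases (nonsymJack_spec hα ν).2.2 μ (right_ne_zero_of_smul h) with rfl | h1
    · exact orbit_prec hη hν
    · rcases orbit_prec hη hν with rfl | h2
      · exact Or.inr h1
      · exact Or.inr (h1.trans h2)

omit [CharZero K] in
theorem IsMonicTriangular.ne_zero {η : Fin (n + 1) → ℕ} {f : MvPolynomial (Fin (n + 1)) K}
    (h : IsMonicTriangular η f) : f ≠ 0 := by
  rintro rfl
  simpa using h.1

end Expansion

/-! ### The (anti)symmetrizer and the character det_J. -/

section Symmetrization

variable {K : Type*} [Field K] {n : ℕ} {I J : Finset (Fin n)}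
  {F : MvPolynomial (Fin (n + 1)) K}

theorem permAct_word (hF : ∀ i ∈ I ∪ J, permAct (simpleRefl i) F = epsSign K J i • F)
    (l : List (Fin n)) (hl : ∀ i ∈ l, i ∈ I ∪ J) :
    permAct (l.map simpleRefl).prod F = ((-1 : K) ^ l.countP fun i => decide (i ∈ J)) • F := by
  induction l with
  | nil => simp [permAct_one]
  | cons i l ih =>
    rw [List.map_cons, List.prod_cons, ← permAct_permAct,
      ih fun j hj => hl j (List.mem_cons_of_mem _ hj), map_smul, hF i (hl i List.mem_cons_self),
      smul_smul, List.countP_cons, epsSign]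
    by_cases h : i ∈ J
    · simp [h, pow_succ]
    · simp [h]

theorem exists_word {A : Finset (Fin n)} {w : Equiv.Perm (Fin (n + 1))} (hw : w ∈ parabolic A) :
    ∃ l : List (Fin n), (∀ i ∈ l, i ∈ A) ∧ (l.map simpleRefl).prod = w := by
  induction hw using parabolic_induction with
  | one => exact ⟨[], by simp, by simp⟩
  | mul w hw i hi h =>
    obtain ⟨l, hl, rfl⟩ := h
    refine ⟨l ++ [i], ?_, by simp⟩
    intro j hj
    rcases List.mem_append.mp hj with h | h
    · exact hl j h
    · rw [List.mem_singleton.mp h]; exact hi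

/-- Any word for w acts on F by its parity in J. A nonzero F of this symmetry type thus shows that
the parity is independent of the word, and multiplicativity of det_J is read off from it without
group combinatorics. -/
theorem permAct_eq_detJ_smul
    (hF : ∀ i ∈ I ∪ J, permAct (simpleRefl i) F = epsSign K J i • F)
    {w : Equiv.Perm (Fin (n + 1))} (hw : w ∈ parabolic (I ∪ J)) :
    permAct w F = (detJ I J w : K) • F := by
  rw [detJ]
  split_ifs with h
  · obtain ⟨l, hl, rfl, he⟩ := h
    rw [permAct_word hF l hl, he.neg_one_pow, Int.cast_one]
  · obtain ⟨l, hl, rfl⟩ := exists_word hw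
    have ho : Odd (l.countP fun i => decide (i ∈ J)) := by
      rw [← Nat.not_even_iff_odd]
      exact fun he => h ⟨l, hl, rfl, he⟩
    rw [permAct_word hF l hl, ho.neg_one_pow, Int.cast_neg, Int.cast_one]

theorem detJ_mul_simpleRefl (h0 : F ≠ 0)
    (hF : ∀ i ∈ I ∪ J, permAct (simpleRefl i) F = epsSign K J i • F)
    {w : Equiv.Perm (Fin (n + 1))} (hw : w ∈ parabolic (I ∪ J)) {i : Fin n} (hi : i ∈ I ∪ J) :
    (detJ I J (w * simpleRefl i) : K) = epsSign K J i * detJ I J w := by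
  have h := permAct_eq_detJ_smul hF (mul_mem hw (simpleRefl_mem_parabolic hi))
  rw [← permAct_permAct, hF i hi, map_smul, permAct_eq_detJ_smul hF hw, smul_smul] at h
  exact (smul_left_injective K h0 h).symm

theorem symAsym_apply (f : MvPolynomial (Fin (n + 1)) K) [DecidablePred (· ∈ parabolic (I ∪ J))] :
    symAsym I J f = ∑ w ∈ Finset.univ.filter (· ∈ parabolic (I ∪ J)),
      (detJ I J w : K) • permAct w f := by
  rw [symAsym, LinearMap.sum_apply]
  simp only [LinearMap.smul_apply, Int.cast_smul_eq_zsmul]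
  congr!

theorem symAsym_permAct (h0 : F ≠ 0)
    (hF : ∀ i ∈ I ∪ J, permAct (simpleRefl i) F = epsSign K J i • F)
    {i : Fin n} (hi : i ∈ I ∪ J) (f : MvPolynomial (Fin (n + 1)) K) :
    symAsym I J (permAct (simpleRefl i) f) = epsSign K J i • symAsym I J f := by
  classical
  rw [symAsym_apply, symAsym_apply, Finset.smul_sum]
  have hmap : ∀ w ∈ Finset.univ.filter (· ∈ parabolic (I ∪ J)),
      w * simpleRefl i ∈ Finset.univ.filter (· ∈ parabolic (I ∪ J)) := by
    intro w hw
    simp only [Finset.mem_filter, Finset.mem_univ, true_and] at hw ⊢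
    exact mul_mem hw (simpleRefl_mem_parabolic hi)
  have hinv : ∀ w : Equiv.Perm (Fin (n + 1)), w * simpleRefl i * simpleRefl i = w := fun w => by
    rw [mul_assoc, simpleRefl_mul_self, mul_one]
  refine Finset.sum_nbij' (· * simpleRefl i) (· * simpleRefl i) hmap hmap
    (fun w _ => hinv w) (fun w _ => hinv w) fun w hw => ?_
  simp only [Finset.mem_filter, Finset.mem_univ, true_and] at hw
  rw [permAct_permAct, detJ_mul_simpleRefl h0 hF hw hi, smul_smul, ← mul_assoc,
    epsSign_mul_self, one_mul]

theorem exists_symAsym_self [CharZero K]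
    (hF : ∀ i ∈ I ∪ J, permAct (simpleRefl i) F = epsSign K J i • F) :
    ∃ m : K, m ≠ 0 ∧ symAsym I J F = m • F := by
  classical
  refine ⟨((Finset.univ.filter (· ∈ parabolic (I ∪ J))).card : K), ?_, ?_⟩
  · rw [Nat.cast_ne_zero, ← Nat.pos_iff_ne_zero, Finset.card_pos]
    exact ⟨1, by simp [one_mem]⟩
  · rw [symAsym_apply, Nat.cast_smul_eq_nsmul, ← Finset.sum_const]
    apply Finset.sum_congr rfl
    intro w hw
    simp only [Finset.mem_filter, Finset.mem_univ, true_and] at hw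
    rw [permAct_eq_detJ_smul hF hw, smul_smul]
    have : (detJ I J w : K) * detJ I J w = 1 := by
      rw [detJ]; split_ifs <;> simp
    rw [this, one_smul]

end Symmetrization

/-! ### Identification of the prescribed-symmetry polynomials and the action of O_J. -/

section Prescribed

variable {K : Type*} [Field K] [CharZero K] {n : ℕ} {α : K} {I J : Finset (Fin n)}

/-- Symmetrizing the formula for s_i E_ν, whose left side becomes ε_i times the symmetrized E_ν,
expresses one neighbour through the other; in the descending case this divides by 1 - d⁻² ≠ 0. -/
theorem symAsym_nonsymJack (hα : ∀ q : ℚ, q ≤ 0 → α ≠ (q : K))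
    {F : MvPolynomial (Fin (n + 1)) K} (h0 : F ≠ 0)
    (hF : ∀ i ∈ I ∪ J, permAct (simpleRefl i) F = epsSign K J i • F) {η : Fin (n + 1) → ℕ} :
    ∀ ν ∈ orbit (I ∪ J) η, ∃ κ : K,
      symAsym I J (nonsymJack α ν) = κ • symAsym I J (nonsymJack α η) := by
  apply orbit_induction
  · exact ⟨1, (one_smul _ _).symm⟩
  · rintro ν - i hi ⟨κ, hκ⟩
    rcases lt_trichotomy (ν i.castSucc) (ν i.succ) with h | h | h
    · have h1 := congrArg (symAsym I J) (permAct_nonsymJack_of_lt hα h)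
      rw [symAsym_permAct h0 hF hi, map_add, map_smul, ← sub_eq_iff_eq_add', ← sub_smul, hκ,
        smul_smul] at h1
      exact ⟨_, h1.symm⟩
    · exact ⟨κ, by rwa [comp_simpleRefl_of_eq h]⟩
    · have h1 := congrArg (symAsym I J) (permAct_nonsymJack_of_gt hα h)
      obtain ⟨hd0, hd1, hd2⟩ := etaBar_sub_ne hα h
      have hB : 1 - (etaBar α ν i.castSucc - etaBar α ν i.succ)⁻¹ ^ 2 ≠ 0 := by
        intro e
        have e1 : (etaBar α ν i.castSucc - etaBar α ν i.succ) ^ 2 = 1 := by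
          field_simp at e
          linear_combination e
        rcases mul_self_eq_one_iff.mp ((sq _).symm.trans e1) with e2 | e2
        · exact hd1 e2
        · exact hd2 e2
      rw [symAsym_permAct h0 hF hi, map_add, map_smul, map_smul, ← sub_eq_iff_eq_add', ← sub_smul,
        hκ, smul_smul] at h1
      exact ⟨_, ((eq_inv_smul_iff₀ hB).mpr h1.symm).trans (smul_smul _ _ _)⟩

theorem isPrescribedJack_expansion (hα : ∀ q : ℚ, q ≤ 0 → α ≠ (q : K)) (hdisj : Disjoint I J)
    (hsep : ∀ i ∈ I, ∀ j ∈ J, (i : ℕ) + 1 ≠ j ∧ (j : ℕ) + 1 ≠ i) {η : Fin (n + 1) → ℕ}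
    (hη : ∀ i ∈ I ∪ J, η i.succ ≤ η i.castSucc) (hηJ : ∀ j ∈ J, η j.succ < η j.castSucc) :
    IsPrescribedJack α I J η (expansion α (I ∪ J) J η) := by
  have hmon := isMonicTriangular_expansion (J := J) hα hη
  refine ⟨?_, hmon⟩
  have h0 := hmon.ne_zero
  have hF : ∀ i ∈ I ∪ J, permAct (simpleRefl i) (expansion α (I ∪ J) J η) =
      epsSign K J i • expansion α (I ∪ J) J η := fun i hi =>
    permAct_expansion hα hdisj hsep hηJ hi
  obtain ⟨m, hm, hmF⟩ := exists_symAsym_self hF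
  choose! κ hκ using symAsym_nonsymJack hα h0 hF (η := η)
  have h1 : symAsym I J (expansion α (I ∪ J) J η) =
      (∑ ν ∈ orbit (I ∪ J) η, expCoeff α (I ∪ J) J ν * κ ν) •
        symAsym I J (nonsymJack α η) := by
    conv_lhs => rw [expansion]
    rw [map_sum, Finset.sum_smul]
    apply Finset.sum_congr rfl
    intro ν hν
    rw [map_smul, hκ ν hν, smul_smul]
  set k := ∑ ν ∈ orbit (I ∪ J) η, expCoeff α (I ∪ J) J ν * κ ν
  -- The symmetrizer multiplies the expansion by the group order `m`, nonzero in characteristic 0,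
  -- and also gives k times the symmetrized E_η. Nonvanishing of k follows without computing it.
  have hk : k ≠ 0 := by
    intro e
    rw [e, zero_smul, hmF] at h1
    exact smul_ne_zero hm h0 h1
  refine ⟨k⁻¹ * m, mul_ne_zero (inv_ne_zero hk) hm, ?_⟩
  rw [mul_smul, ← hmF, h1, inv_smul_smul₀ hk]

omit [CharZero K] in
theorem IsPrescribedJack.unique {η : Fin (n + 1) → ℕ} {S T : MvPolynomial (Fin (n + 1)) K}
    (hS : IsPrescribedJack α I J η S) (hT : IsPrescribedJack α I J η T) : S = T := by
  obtain ⟨⟨a, ha, haS⟩, hS1⟩ := hS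
  obtain ⟨⟨b, hb, hbT⟩, hT1⟩ := hT
  have h : a • S = b • T := haS.symm.trans hbT
  have h1 := congrArg (coef η) h
  rw [map_smul, map_smul, coef_apply, coef_apply, hS1.1, hT1.1, smul_eq_mul, smul_eq_mul,
    mul_one, mul_one] at h1
  subst h1
  exact smul_right_injective _ ha h

theorem prescribedJack_eq_expansion (hα : ∀ q : ℚ, q ≤ 0 → α ≠ (q : K)) (hdisj : Disjoint I J)
    (hsep : ∀ i ∈ I, ∀ j ∈ J, (i : ℕ) + 1 ≠ j ∧ (j : ℕ) + 1 ≠ i) {η : Fin (n + 1) → ℕ}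
    (hη : ∀ i ∈ I ∪ J, η i.succ ≤ η i.castSucc) (hηJ : ∀ j ∈ J, η j.succ < η j.castSucc) :
    prescribedJack α I J η = expansion α (I ∪ J) J η := by
  have h := isPrescribedJack_expansion hα hdisj hsep hη hηJ
  exact (Classical.epsilon_spec ⟨_, h⟩ : IsPrescribedJack α I J η _).unique h

omit [CharZero K] in
theorem cherednikD_root_of_joint_eigenvector {f : MvPolynomial (Fin (n + 1)) K}
    {c : Fin (n + 1) → K} (hf : ∀ i, xi α i f = c i • f) (b : Fin (n + 1) × Fin (n + 1)) :
    cherednikD α (root b) f = (α⁻¹ * (c b.1 - c b.2)) • f := by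
  -- The shift (N - 1)/2 drops out because the coordinates of a root sum to 0.
  have h : ∑ j, (root b j : K) * (c j + (n : K) / 2) = c b.1 - c b.2 := by
    simp only [root, Pi.sub_apply, sub_mul, Finset.sum_sub_distrib, Pi.single_apply, ite_mul,
      one_mul, zero_mul, Finset.sum_ite_eq', Finset.mem_univ, if_true]
    ring
  rw [cherednikD, LinearMap.smul_apply, LinearMap.sum_apply, mul_smul, ← h, Finset.sum_smul]
  congr 1
  apply Finset.sum_congr rfl
  intro j _
  rw [LinearMap.smul_apply, LinearMap.add_apply, hf, LinearMap.smul_apply, Module.End.one_apply,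
    ← add_smul, smul_smul]

omit [CharZero K] in
-- Every factor acts on a joint eigenvector by a scalar, so the order of the factors is immaterial.
theorem opO_of_joint_eigenvector {f : MvPolynomial (Fin (n + 1)) K}
    {c : Fin (n + 1) → K} (hf : ∀ i, xi α i f = c i • f)
    (L : List (Fin (n + 1) × Fin (n + 1))) :
    opO α L f = (L.map fun b => (c b.1 - c b.2 + 1) / α).prod • f := by
  induction L with
  | nil => simp [opO]
  | cons b L ih =>
    have h : opO α (b :: L) f = (cherednikD α (root b) + (1 / α) • 1) (opO α L f) := by
      simp only [opO, List.map_cons, List.prod_cons, Module.End.mul_apply]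
    rw [h, ih, map_smul, LinearMap.add_apply, LinearMap.smul_apply, Module.End.one_apply,
      cherednikD_root_of_joint_eigenvector hf, ← add_smul, smul_smul, List.map_cons,
      List.prod_cons]
    congr 1
    ring

theorem opO_expansion (hα : ∀ q : ℚ, q ≤ 0 → α ≠ (q : K)) (hdisj : Disjoint I J)
    (hsep : ∀ i ∈ I, ∀ j ∈ J, (i : ℕ) + 1 ≠ j ∧ (j : ℕ) + 1 ≠ i) {η : Fin (n + 1) → ℕ}
    (hη : ∀ i ∈ I ∪ J, η i.succ ≤ η i.castSucc)
    {L : List (Fin (n + 1) × Fin (n + 1))} (hL : L.Nodup) (hLJ : ∀ b, b ∈ L ↔ b ∈ posRoots J) :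
    opO α L (expansion α (I ∪ J) J η) = constC α J η • expansion α (I ∪ J) ∅ η := by
  have hc : ∀ ν : Fin (n + 1) → ℕ,
      (L.map fun b => (etaBar α ν b.1 - etaBar α ν b.2 + 1) / α).prod = constC α J ν := by
    intro ν
    rw [← List.prod_toFinset _ hL, constC]
    congr 1
    ext b
    rw [List.mem_toFinset, hLJ]
  rw [expansion, expansion, map_sum, Finset.smul_sum]
  apply Finset.sum_congr rfl
  intro ν hν
  rw [map_smul, opO_of_joint_eigenvector (nonsymJack_spec hα ν).1, hc, smul_smul, smul_smul,
    expCoeff_mul_constC hα hdisj hsep hη ν hν]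

end Prescribed

end PrescribedJack

open PrescribedJack
theorem mainTheorem6 {K : Type*} [Field K] [CharZero K] {n : ℕ}
    (α : K) (hα : ∀ q : ℚ, q ≤ 0 → α ≠ (q : K))
    (I J : Finset (Fin n)) (hdisj : Disjoint I J)
    (hsep : ∀ i ∈ I, ∀ j ∈ J, (i : ℕ) + 1 ≠ j ∧ (j : ℕ) + 1 ≠ i)
    (η : Fin (n + 1) → ℕ)
    (hηI : ∀ i ∈ I, η i.succ ≤ η i.castSucc)
    (hηJ : ∀ j ∈ J, η j.succ < η j.castSucc)
    (L : List (Fin (n + 1) × Fin (n + 1))) (hL : L.Nodup)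
    (hLJ : ∀ b, b ∈ L ↔ b ∈ posRoots J) :
    IsNonsymJack α η (nonsymJack α η) ∧
    IsPrescribedJack α I J η (prescribedJack α I J η) ∧
    IsPrescribedJack α (I ∪ J) ∅ η (prescribedJack α (I ∪ J) ∅ η) ∧
    (∀ i ∈ I ∪ J, permAct (simpleRefl i) (opO α L (prescribedJack α I J η)) =
      opO α L (prescribedJack α I J η)) ∧
    opO α L (prescribedJack α I J η) =
      constC α J η • prescribedJack α (I ∪ J) ∅ η := by
  have hη : ∀ i ∈ I ∪ J, η i.succ ≤ η i.castSucc := by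
    intro i hi
    rcases Finset.mem_union.mp hi with h | h
    · exact hηI i h
    · exact (hηJ i h).le
  have hdisj' : Disjoint (I ∪ J) ∅ := Finset.disjoint_empty_right _
  have hsep' : ∀ i ∈ I ∪ J, ∀ j ∈ (∅ : Finset (Fin n)), (i : ℕ) + 1 ≠ j ∧ (j : ℕ) + 1 ≠ i :=
    fun _ _ j hj => absurd hj (Finset.notMem_empty j)
  have hη' : ∀ i ∈ (I ∪ J) ∪ ∅, η i.succ ≤ η i.castSucc := by rwa [Finset.union_empty]
  have hηJ' : ∀ j ∈ (∅ : Finset (Fin n)), η j.succ < η j.castSucc :=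
    fun j hj => absurd hj (Finset.notMem_empty j)
  have h1 := isPrescribedJack_expansion hα hdisj hsep hη hηJ
  have h2 := isPrescribedJack_expansion hα hdisj' hsep' hη' hηJ'
  have e1 := prescribedJack_eq_expansion hα hdisj hsep hη hηJ
  have e2 := prescribedJack_eq_expansion hα hdisj' hsep' hη' hηJ'
  have h3 : ∀ i ∈ I ∪ J, permAct (simpleRefl i) (expansion α (I ∪ J) ∅ η) =
      expansion α (I ∪ J) ∅ η := by
    intro i hi
    have := permAct_expansion (i := i) hα hdisj' hsep' hηJ' (by rwa [Finset.union_empty])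
    rwa [Finset.union_empty, epsSign, if_neg (Finset.notMem_empty i), one_smul] at this
  rw [Finset.union_empty] at h2 e2
  rw [e1, e2, opO_expansion hα hdisj hsep hη hL hLJ]
  exact ⟨nonsymJack_spec hα η, h1, h2, fun i hi => by rw [map_smul, h3 i hi], rfl⟩
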